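/- Let $n,k\ge 0$ and let $F_{n,k}$ be the free group on $x_1,\dots,x_n,y_1,\dots,y_k$; write $[z]\in\mathbb{Z}^{n+k}$ for the image of $z\in F_{n,k}$ in the abelianization $F_{n,k}^{\mathrm{ab}}=\mathbb{Z}^{n+k}$. Let $IA_{n,k}\subset\mathrm{Aut}(F_{n,k})$ be the Torelli subgroup, that is, the group of automorphisms acting trivially on $F_{n,k}^{\mathrm{ab}}$. Let $\mathrm{Aut}(F_{n,k})^B$ be the group of all $f\in\mathrm{Aut}(F_{n,k})$ such that $f(y_i)$ is conjugate to $y_i$ for $1\le i\le k$, let $\mathcal{K}_{n,k}$ be the kernel of the map $\mathrm{Aut}(F_{n,k})^B\to\mathrm{Aut}(F_n)$ induced by the projection $F_{n,k}\to F_n$ that kills all the $y_i$, and put $\mathcal{K}IA_{n,k}=\mathcal{K}_{n,k}\cap IA_{n,k}$. Let $\pi\colon[F_{n,k},F_{n,k}]\to\bigwedge^2\mathbb{Z}^{n+k}$ be the homomorphism with $\pi([z,z'])=[z]\wedge[z']$ for all $z,z'\in F_{n,k}$, and let $\tau\colon IA_{n,k}\to\mathrm{Hom}(\mathbb{Z}^{n+k},\bigwedge^2\mathbb{Z}^{n+k})$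 be the Johnson homomorphism, the homomorphism with $\tau(f)([z])=\pi(f(z)z^{-1})$ for all $f\in IA_{n,k}$ and $z\in F_{n,k}$. **Theorem C.** The group $H_1(\mathcal{K}IA_{n,k};\mathbb{Z})$ is free abelian of finite rank $$n(n-1)k+n\binom{k}{2}+2nk+k(k-1).$$ The abelianization map of $\mathcal{K}IA_{n,k}$ is given by the restriction of $\tau$ to $\mathcal{K}IA_{n,k}$: there is an injective homomorphism $J\colon H_1(\mathcal{K}IA_{n,k};\mathbb{Z})\to\mathrm{Hom}(\mathbb{Z}^{n+k},\bigwedge^2\mathbb{Z}^{n+k})$ such that $J$ maps the class of each $g\in\mathcal{K}IA_{n,k}$ to $\tau(g)$. Equivalently, $\tau|_{\mathcal{K}IA_{n,k}}$, regarded as a map onto its image, is the abelianization of $\mathcal{K}IA_{n,k}$. -/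

import Mathlib

noncomputable section

namespace BirmanTorelli

open scoped commutatorElement

/-! ## The Torelli subgroup of the automorphism group of a free group -/

/-- The action of `Aut(G)` on the abelianization of `G`. -/
def autAb (G : Type*) [Group G] : MulAut G →* MulAut (Abelianization G) where
  toFun f := MulEquiv.abelianizationCongr f
  map_one' := by
    ext x
    induction x using QuotientGroup.induction_on with
    | _ z => rfl
  map_mul' f g := by
    ext x
    induction x using QuotientGroup.induction_on with
    | _ z => rfl

/-- The Torelli subgroup `IA` of `Aut(F)`, where `F` is the free group on `ι`: the automorphisms
which act trivially on the abelianization of `F`. -/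
def IA (ι : Type*) : Subgroup (MulAut (FreeGroup ι)) := (autAb (FreeGroup ι)).ker

/-- The abelianization map `z ↦ [z]` from the free group on `ι` to `ℤ^ι`,
sending a basis element to the corresponding standard basis vector. -/
def cls (ι : Type*) [DecidableEq ι] : FreeGroup ι →* Multiplicative (ι → ℤ) :=
  FreeGroup.lift fun i => Multiplicative.ofAdd (Pi.single i 1)

theorem cls_of_mem_IA {ι : Type*} [DecidableEq ι] {f : MulAut (FreeGroup ι)} (hf : f ∈ IA ι)
    (z : FreeGroup ι) : cls ι (f z) = cls ι z := by
  have h : Abelianization.of (f z) = Abelianization.of z :=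
    DFunLike.congr_fun (MonoidHom.mem_ker.mp hf) (Abelianization.of z)
  simpa using congrArg (Abelianization.lift (cls ι)) h

/-! ## The projection from the commutator subgroup of a free group to `⋀² ℤ^ι` -/

/-- The wedge product `a ∧ b`. -/
def wedge {ι : Type*} (a b : ι → ℤ) : ⋀[ℤ]^2 (ι → ℤ) := exteriorPower.ιMulti ℤ 2 ![a, b]

section Projection

variable (ι : Type*) [Fintype ι] [DecidableEq ι]

open Classical in
/-- The bilinear map with `(e i, e j) ↦ e i ∧ e j` if `i` precedes `j` in a fixed linear order of
the index set, and `(e i, e j) ↦ 0` otherwise. Its antisymmetrization is the wedge product. -/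
def halfWedge : (ι → ℤ) →ₗ[ℤ] (ι → ℤ) →ₗ[ℤ] ⋀[ℤ]^2 (ι → ℤ) :=
  (Pi.basisFun ℤ ι).constr ℤ fun i => (Pi.basisFun ℤ ι).constr ℤ fun j =>
    if WellOrderingRel i j then wedge (Pi.single i 1) (Pi.single j 1) else 0

/-- The wedge product as a bilinear map. -/
def wedgeBilin : (ι → ℤ) →ₗ[ℤ] (ι → ℤ) →ₗ[ℤ] ⋀[ℤ]^2 (ι → ℤ) :=
  have h0 : ∀ a b c : ι → ℤ, Function.update ![a, c] 0 b = ![b, c] := fun a b c => by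
    funext i
    fin_cases i <;> rfl
  have h1 : ∀ a b c : ι → ℤ, Function.update ![a, c] 1 b = ![a, b] := fun a b c => by
    funext i
    fin_cases i <;> rfl
  LinearMap.mk₂ ℤ wedge
    (fun a b c => by
      have h := (exteriorPower.ιMulti ℤ 2).map_update_add ![a, c] 0 a b
      rwa [h0, h0, h0] at h)
    (fun r a c => by
      have h := (exteriorPower.ιMulti ℤ 2).map_update_smul ![a, c] 0 r a
      rwa [h0, h0] at h)
    (fun a b c => by
      have h := (exteriorPower.ιMulti ℤ 2).map_update_add ![a, b] 1 b c
      rwa [h1, h1, h1] at h)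
    (fun r a c => by
      have h := (exteriorPower.ιMulti ℤ 2).map_update_smul ![a, c] 1 r c
      rwa [h1, h1] at h)

theorem wedge_self {ι : Type*} (a : ι → ℤ) : wedge a a = 0 :=
  (exteriorPower.ιMulti ℤ 2).map_eq_zero_of_eq ![a, a] (i := 0) (j := 1) rfl (by decide)

theorem wedge_swap {ι : Type*} (a b : ι → ℤ) : wedge a b = -wedge b a := by
  have h := (exteriorPower.ιMulti ℤ 2).map_swap ![b, a] (i := 0) (j := 1) (by decide)
  rw [← wedge] at h
  rw [← h, wedge]
  congr 1
  funext i
  fin_cases i <;> rfl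

theorem halfWedge_sub_flip : halfWedge ι - (halfWedge ι).flip = wedgeBilin ι := by
  refine (Pi.basisFun ℤ ι).ext fun i => (Pi.basisFun ℤ ι).ext fun j => ?_
  have key : ∀ i j, halfWedge ι (Pi.basisFun ℤ ι i) (Pi.basisFun ℤ ι j) =
      (open Classical in
        if WellOrderingRel i j then wedge (Pi.single i 1) (Pi.single j 1) else 0) := by
    intro i j
    rw [halfWedge, Module.Basis.constr_basis, Module.Basis.constr_basis]
  have hw : wedgeBilin ι (Pi.basisFun ℤ ι i) (Pi.basisFun ℤ ι j) =
      wedge (Pi.single i 1) (Pi.single j 1) := by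
    rw [Pi.basisFun_apply, Pi.basisFun_apply]
    rfl
  rw [hw, LinearMap.sub_apply, LinearMap.sub_apply, LinearMap.flip_apply, key, key]
  rcases trichotomous_of (WellOrderingRel (α := ι)) i j with h | h | h
  · rw [if_pos h, if_neg (asymm_of WellOrderingRel h), sub_zero]
  · subst h
    rw [sub_self, wedge_self]
  · rw [if_pos h, if_neg (asymm_of WellOrderingRel h), zero_sub, ← wedge_swap]

/-- A central extension of `ℤ^ι` by `⋀² ℤ^ι`: the group of pairs `(a, u)` with `(a, u) * (b, v) = (a + b, u + v + halfWedge a b)`. -/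
@[ext]
structure Heis where
  /-- the component in `ℤ^ι` -/
  fst : ι → ℤ
  /-- the central component -/
  snd : ⋀[ℤ]^2 (ι → ℤ)

instance : Group (Heis ι) where
  mul p q := ⟨p.fst + q.fst, p.snd + q.snd + halfWedge ι p.fst q.fst⟩
  one := ⟨0, 0⟩
  inv p := ⟨-p.fst, -p.snd + halfWedge ι p.fst p.fst⟩
  mul_assoc p q r := by
    apply Heis.ext
    · exact add_assoc _ _ _
    · change (p.snd + q.snd + halfWedge ι p.fst q.fst) + r.snd
          + halfWedge ι (p.fst + q.fst) r.fst
        = p.snd + (q.snd + r.snd + halfWedge ι q.fst r.fst)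
          + halfWedge ι p.fst (q.fst + r.fst)
      rw [map_add, map_add, LinearMap.add_apply]
      abel
  one_mul p := by
    apply Heis.ext
    · exact zero_add _
    · change 0 + p.snd + halfWedge ι 0 p.fst = p.snd
      simp
  mul_one p := by
    apply Heis.ext
    · exact add_zero _
    · change p.snd + 0 + halfWedge ι p.fst 0 = p.snd
      simp
  inv_mul_cancel p := by
    apply Heis.ext
    · exact neg_add_cancel _
    · change -p.snd + halfWedge ι p.fst p.fst + p.snd + halfWedge ι (-p.fst) p.fst = 0
      rw [map_neg, LinearMap.neg_apply]
      abel

theorem Heis.fst_mul (p q : Heis ι) : (p * q).fst = p.fst + q.fst := rfl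

theorem Heis.snd_mul (p q : Heis ι) :
    (p * q).snd = p.snd + q.snd + halfWedge ι p.fst q.fst := rfl

theorem Heis.fst_inv (p : Heis ι) : (p⁻¹).fst = -p.fst := rfl

theorem Heis.snd_inv (p : Heis ι) : (p⁻¹).snd = -p.snd + halfWedge ι p.fst p.fst := rfl

theorem Heis.snd_commutator (p q : Heis ι) : (⁅p, q⁆).snd = wedge p.fst q.fst := by
  have h : halfWedge ι p.fst q.fst - halfWedge ι q.fst p.fst = wedge p.fst q.fst :=
    DFunLike.congr_fun (DFunLike.congr_fun (halfWedge_sub_flip ι) p.fst) q.fst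
  rw [← h]
  simp only [commutatorElement_def, Heis.snd_mul, Heis.fst_mul, Heis.snd_inv, Heis.fst_inv,
    map_add, map_neg, LinearMap.add_apply, LinearMap.neg_apply]
  abel

/-- The homomorphism from the free group which sends the basis element `i` to `(e i, 0)`. -/
def toHeis : FreeGroup ι →* Heis ι := FreeGroup.lift fun i => ⟨Pi.single i 1, 0⟩

theorem toHeis_fst (z : FreeGroup ι) : (toHeis ι z).fst = (cls ι z).toAdd := by
  let φ : Heis ι →* Multiplicative (ι → ℤ) :=
    { toFun p := Multiplicative.ofAdd p.fst
      map_one' := rfl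
      map_mul' _ _ := rfl }
  have h : φ.comp (toHeis ι) = cls ι := by
    ext1 i
    simp [φ, toHeis, cls]
  exact congrArg Multiplicative.toAdd (DFunLike.congr_fun h z)

theorem cls_of_mem_commutator (ι : Type*) [DecidableEq ι] {c : FreeGroup ι}
    (hc : c ∈ commutator (FreeGroup ι)) :
    cls ι c = 1 :=
  Abelianization.commutator_subset_ker (cls ι) hc

theorem toHeis_fst_of_mem {c : FreeGroup ι} (hc : c ∈ commutator (FreeGroup ι)) :
    (toHeis ι c).fst = 0 := by
  rw [toHeis_fst, cls_of_mem_commutator ι hc, toAdd_one]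

/-- The projection `[F, F] → ⋀² ℤ^ι`, where `F` is the free group on `ι`. It is the unique
homomorphism sending every commutator `[z, z']` to `[z] ∧ [z']`. -/
def commProj : commutator (FreeGroup ι) →* Multiplicative (⋀[ℤ]^2 (ι → ℤ)) where
  toFun c := Multiplicative.ofAdd (toHeis ι c).snd
  map_one' := by
    rw [OneMemClass.coe_one, map_one]
    rfl
  map_mul' c d := by
    rw [Subgroup.coe_mul, map_mul, Heis.snd_mul, toHeis_fst_of_mem ι c.2, map_zero,
      LinearMap.zero_apply, add_zero, ofAdd_add]

theorem commProj_commutator (z w : FreeGroup ι)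
    (h : ⁅z, w⁆ ∈ commutator (FreeGroup ι)) :
    (commProj ι ⟨⁅z, w⁆, h⟩).toAdd = wedge (cls ι z).toAdd (cls ι w).toAdd := by
  change (toHeis ι ⁅z, w⁆).snd = _
  rw [map_commutatorElement, Heis.snd_commutator, toHeis_fst, toHeis_fst]

theorem commProj_unique (p : commutator (FreeGroup ι) →* Multiplicative (⋀[ℤ]^2 (ι → ℤ)))
    (hp : ∀ (z w : FreeGroup ι) (h : ⁅z, w⁆ ∈ commutator (FreeGroup ι)),
      (p ⟨⁅z, w⁆, h⟩).toAdd = wedge (cls ι z).toAdd (cls ι w).toAdd) :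
    p = commProj ι := by
  ext1 ⟨c, hc⟩
  have hc' := hc
  rw [commutator_eq_closure] at hc'
  induction hc' using Subgroup.closure_induction with
  | mem x hx =>
    obtain ⟨z, w, rfl⟩ := hx
    exact Multiplicative.toAdd.injective ((hp z w hc).trans (commProj_commutator ι z w hc).symm)
  | one => exact (map_one p).trans (map_one (commProj ι)).symm
  | mul x y hx hy ihx ihy =>
    rw [← commutator_eq_closure] at hx hy
    have e : (⟨x * y, hc⟩ : commutator (FreeGroup ι)) = ⟨x, hx⟩ * ⟨y, hy⟩ := rfl
    rw [e, map_mul, map_mul, ihx hx, ihy hy]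
  | inv x hx ih =>
    rw [← commutator_eq_closure] at hx
    have e : (⟨x⁻¹, hc⟩ : commutator (FreeGroup ι)) = ⟨x, hx⟩⁻¹ := rfl
    rw [e, map_inv, map_inv, ih hx]

end Projection

/-! ## The Johnson homomorphism -/

section Johnson

variable (ι : Type*) [Fintype ι] [DecidableEq ι]

theorem mul_inv_mem_commutator {ι : Type*} {f : MulAut (FreeGroup ι)} (hf : f ∈ IA ι)
    (z : FreeGroup ι) : f z * z⁻¹ ∈ commutator (FreeGroup ι) := by
  have h : Abelianization.of (f z) = Abelianization.of z :=
    DFunLike.congr_fun (MonoidHom.mem_ker.mp hf) (Abelianization.of z)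
  rw [← Abelianization.ker_of, MonoidHom.mem_ker, map_mul, map_inv, h, mul_inv_cancel]

/-- For `f` in the Torelli group, the element `π (f z * z⁻¹)` of `⋀² ℤ^ι`, where `π` is the
projection from the commutator subgroup. -/
def johnsonVal (f : IA ι) (z : FreeGroup ι) : ⋀[ℤ]^2 (ι → ℤ) :=
  (commProj ι ⟨f.1 z * z⁻¹, mul_inv_mem_commutator f.2 z⟩).toAdd

theorem johnsonVal_eq (f : IA ι) (z : FreeGroup ι) :
    johnsonVal ι f z = (toHeis ι (f.1 z)).snd - (toHeis ι z).snd := by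
  have hf : (toHeis ι (f.1 z)).fst = (toHeis ι z).fst := by
    rw [toHeis_fst, toHeis_fst, cls_of_mem_IA f.2]
  change (toHeis ι (f.1 z * z⁻¹)).snd = _
  rw [map_mul, map_inv, Heis.snd_mul, Heis.snd_inv, Heis.fst_inv, hf, map_neg]
  abel

theorem johnsonVal_mul_right (f : IA ι) (z w : FreeGroup ι) :
    johnsonVal ι f (z * w) = johnsonVal ι f z + johnsonVal ι f w := by
  have h : ∀ u, (toHeis ι (f.1 u)).fst = (toHeis ι u).fst := fun u => by
    rw [toHeis_fst, toHeis_fst, cls_of_mem_IA f.2]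
  rw [johnsonVal_eq, johnsonVal_eq, johnsonVal_eq]
  simp only [map_mul, Heis.snd_mul, h]
  abel

/-- The linear map `ℤ^ι → ⋀² ℤ^ι` with `[z] ↦ π (f z * z⁻¹)` for all `z`
(see `johnsonLin_cls`), given here by its values on the basis. -/
def johnsonLin (f : IA ι) : (ι → ℤ) →ₗ[ℤ] ⋀[ℤ]^2 (ι → ℤ) :=
  (Pi.basisFun ℤ ι).constr ℤ fun i => johnsonVal ι f (FreeGroup.of i)

theorem johnsonLin_cls (f : IA ι) (z : FreeGroup ι) :
    johnsonLin ι f (cls ι z).toAdd = johnsonVal ι f z := by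
  let v : FreeGroup ι →* Multiplicative (⋀[ℤ]^2 (ι → ℤ)) :=
    MonoidHom.mk' (fun z => Multiplicative.ofAdd (johnsonVal ι f z)) fun z w => by
      rw [johnsonVal_mul_right, ofAdd_add]
  have h : (AddMonoidHom.toMultiplicative (johnsonLin ι f).toAddMonoidHom).comp (cls ι) = v := by
    ext1 i
    have e : cls ι (FreeGroup.of i) = Multiplicative.ofAdd (Pi.basisFun ℤ ι i) := by
      simp [cls]
    rw [MonoidHom.comp_apply, e]
    exact congrArg Multiplicative.ofAdd ((Pi.basisFun ℤ ι).constr_basis ℤ _ i)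
  exact congrArg Multiplicative.toAdd (DFunLike.congr_fun h z)

/-- The Johnson homomorphism `τ : IA → Hom(ℤ^ι, ⋀² ℤ^ι)`. -/
def johnson : IA ι →* Multiplicative ((ι → ℤ) →ₗ[ℤ] ⋀[ℤ]^2 (ι → ℤ)) :=
  MonoidHom.mk' (fun f => Multiplicative.ofAdd (johnsonLin ι f)) fun f g => by
    rw [← ofAdd_add]
    congr 1
    refine (Pi.basisFun ℤ ι).ext fun i => ?_
    have e : Pi.basisFun ℤ ι i = (cls ι (FreeGroup.of i)).toAdd := by
      simp [cls]
    have h : johnsonVal ι f (g.1 (FreeGroup.of i)) = johnsonVal ι f (FreeGroup.of i) := by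
      rw [← johnsonLin_cls, ← johnsonLin_cls, cls_of_mem_IA g.2]
    rw [e, LinearMap.add_apply, johnsonLin_cls, johnsonLin_cls, johnsonLin_cls, ← h]
    rw [johnsonVal_eq, johnsonVal_eq, johnsonVal_eq]
    exact (sub_add_sub_cancel _ _ _).symm

/-- The defining formula `τ(f)([z]) = π (f z * z⁻¹)` of the Johnson homomorphism. -/
theorem johnson_apply_cls (f : IA ι) (z : FreeGroup ι) :
    (johnson ι f).toAdd (cls ι z).toAdd =
      (commProj ι ⟨f.1 z * z⁻¹, mul_inv_mem_commutator f.2 z⟩).toAdd :=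
  johnsonLin_cls ι f z

end Johnson

/-! ## The kernel of the Birman exact sequence -/

section Birman

variable (n k : ℕ)

/-- The free group `F_{n,k}` on `x_1, …, x_n, y_1, …, y_k`. -/
abbrev F : Type := FreeGroup (Fin n ⊕ Fin k)

variable {n k} in
/-- The generator `y_j`. -/
def y (j : Fin k) : F n k := FreeGroup.of (Sum.inr j)

/-- The automorphisms of `F_{n,k}` which preserve the conjugacy class of each `y_j`. -/
def autB : Subgroup (MulAut (F n k)) where
  carrier := {f | ∀ j, ConjClasses.mk (f (y j)) = ConjClasses.mk (y j)}
  one_mem' _ := rfl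
  mul_mem' {f g} hf hg j := by
    have h := f.toMonoidHom.map_isConj (ConjClasses.mk_eq_mk_iff_isConj.mp (hg j))
    exact (ConjClasses.mk_eq_mk_iff_isConj.mpr h).trans (hf j)
  inv_mem' {f} hf j := by
    have h := (f⁻¹).toMonoidHom.map_isConj (ConjClasses.mk_eq_mk_iff_isConj.mp (hf j))
    have e : (f⁻¹).toMonoidHom (f (y j)) = y j := MulAut.inv_apply_self _ f _
    rw [e] at h
    exact ConjClasses.mk_eq_mk_iff_isConj.mpr h.symm

/-- The map `F_{n,k} → F_n` which kills each `y_j`. -/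
def killY : F n k →* FreeGroup (Fin n) :=
  FreeGroup.lift (Sum.elim FreeGroup.of fun _ => 1)

/-- The inclusion `F_n → F_{n,k}`. -/
def inclX : FreeGroup (Fin n) →* F n k := FreeGroup.map Sum.inl

theorem killY_inclX (w : FreeGroup (Fin n)) : killY n k (inclX n k w) = w := by
  have h : (killY n k).comp (inclX n k) = MonoidHom.id _ := by
    ext1 i
    simp [killY, inclX]
  exact DFunLike.congr_fun h w

theorem killY_autB (f : autB n k) (z : F n k) :
    killY n k (f.1 (inclX n k (killY n k z))) = killY n k (f.1 z) := by
  have h : (((killY n k).comp f.1.toMonoidHom).comp (inclX n k)).comp (killY n k) =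
      (killY n k).comp f.1.toMonoidHom := by
    ext1 s
    rcases s with i | j
    · simp [killY, inclX]
    · have hc := (killY n k).map_isConj (ConjClasses.mk_eq_mk_iff_isConj.mp (f.2 j))
      have hy : killY n k (y j) = 1 := by simp [killY, y]
      rw [hy, isConj_one_left] at hc
      have hy' : killY n k (FreeGroup.of (Sum.inr j)) = 1 := hy
      simp only [MonoidHom.comp_apply, hy', map_one]
      exact hc.symm
  exact DFunLike.congr_fun h z

/-- The map `π : Aut(F_{n,k})^B → Aut(F_n)` induced by `F_{n,k} → F_n` (see `birmanProj_killY`). -/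
def birmanProj : autB n k →* MulAut (FreeGroup (Fin n)) where
  toFun f :=
    { toFun w := killY n k (f.1 (inclX n k w))
      invFun w := killY n k ((f⁻¹).1 (inclX n k w))
      left_inv w := by
        beta_reduce
        rw [killY_autB n k f⁻¹, InvMemClass.coe_inv, MulAut.inv_apply_self, killY_inclX]
      right_inv w := by
        beta_reduce
        rw [killY_autB n k f, InvMemClass.coe_inv, MulAut.apply_inv_self, killY_inclX]
      map_mul' v w := by rw [map_mul, map_mul, map_mul] }
  map_one' := by
    ext1 w
    exact killY_inclX n k w
  map_mul' f g := by
    ext1 w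
    exact (killY_autB n k f _).symm

theorem birmanProj_killY (f : autB n k) (z : F n k) :
    birmanProj n k f (killY n k z) = killY n k (f.1 z) :=
  killY_autB n k f z

/-- The kernel `𝒦_{n,k}` of `π : Aut(F_{n,k})^B → Aut(F_n)`, as a subgroup of `Aut(F_{n,k})`. -/
def K : Subgroup (MulAut (F n k)) := (birmanProj n k).ker.map (autB n k).subtype

/-- The group `𝒦IA_{n,k}`: the intersection of `𝒦_{n,k}` with the Torelli group `IA_{n,k}`. -/
def KIA : Subgroup (MulAut (F n k)) := K n k ⊓ IA (Fin n ⊕ Fin k)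

/-- The restriction of the Johnson homomorphism to `𝒦IA_{n,k}`. -/
def johnsonKIA : KIA n k →*
    Multiplicative ((Fin n ⊕ Fin k → ℤ) →ₗ[ℤ] ⋀[ℤ]^2 (Fin n ⊕ Fin k → ℤ)) :=
  (johnson (Fin n ⊕ Fin k)).comp (Subgroup.inclusion inf_le_right)

end Birman

/-! ## The first homology group -/

section Homology

variable (G : Type) [Group G]

/-- `H₁(G; ℤ)`, the group homology with coefficients in the trivial module `ℤ`. -/
abbrev H1 : Type := groupHomology.H1 (Rep.trivial ℤ G ℤ)

variable {G} in
/-- The abelianization map `G → H₁(G; ℤ)`, sending `g` to the class of the 1-cycle `g`. -/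
def h1Class (g : G) : H1 G :=
  groupHomology.mkH1OfIsTrivial (Rep.trivial ℤ G ℤ) (Additive.ofMul (Abelianization.of g)) (1 : ℤ)

end Homology

end BirmanTorelli

end

/-!
The proof is a computation of generators. Write `𝒦` for the kernel of the Birman exact sequence and
`𝒦IA` for its Torelli part. There is a list of as many elements of `𝒦IA` as the rank in the theorem
(`torelliGenerator`, counted in `card_generatorIndex`) with two properties:

* They generate `𝒦IA` modulo its commutator subgroup (`KIA_eq_torelliSpan`).
* Their images under the Johnson homomorphism are, up to sign, distinct members of the standard
  basis of `Hom(ℤ^{n+k}, ⋀² ℤ^{n+k})`, hence linearly independent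
  (`linearIndependent_johnsonKIA_generator`).

Consequently their classes span the first homology group and are independent there, so that they
form a basis, and the map induced by the Johnson homomorphism is injective, as it maps this basis to
an independent family.

The generation statement rests on generators of `𝒦` (`K_eq_closure`): the multiplications of an
`x_i` by a `y_j` on either side and the conjugations of a `y_j` by another basis element. These come
from a Nielsen reduction that respects the conjugacy classes of the `y_j`
(`exists_mem_closure_elementaryAut`). Given `f` with `f (y_j) = w_j y_j w_j⁻¹`, one composes `f`
with elementary automorphisms that multiply an `x_i`, or conjugate a `y_j`, by another letter, as
long as this lowers the total length of the images of the basis or, at equal length, the total code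
of their halves. If no such step is possible, then a product of images of letters keeps at least one
letter of every factor (`NielsenReduced.exists_toWord_eq`), so `f` cannot decrease word length and
`f⁻¹` maps letters to letters. The elementary automorphisms that lie outside `𝒦` are Nielsen
automorphisms of the `x_i`. They normalize the subgroup generated by the others
(`nielsen_conj_mem_closure`), so an element of `𝒦` is a product of the others.

To pass to `𝒦IA`, let `H` be the subgroup generated by the list and by `[𝒦IA, 𝒦IA]`. Each of the
generators of `𝒦` lies in `H`, or is up to `H` a left multiplication of `x_i` by `y_j`. The latter
normalize `H` (`conj_torelliGenerator_mem_span`) and commute modulo `H`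
(`commutator_leftMul_mem`), and they act on the abelianization of the free group as a basis of a
free abelian group. So an element of `𝒦` that acts trivially there lies in `H`
(`ker_le_of_commutator_mem`).
-/

noncomputable section

namespace BirmanTorelli

open FreeGroup hiding map_one map_mul map_inv

/-! ### Transvections and partial conjugations -/

section Transvection

variable {α : Type*}

/-- The subgroup of a free group generated by all basis elements other than `s`. -/
def avoiding (s : α) : Subgroup (FreeGroup α) := Subgroup.closure (of '' {t | t ≠ s})

theorem of_mem_avoiding {s t : α} (h : t ≠ s) : of t ∈ avoiding s :=
  Subgroup.subset_closure ⟨t, h, rfl⟩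

/-- Automorphisms of a free group are determined by their values on the basis. -/
theorem mulAut_ext {f g : MulAut (FreeGroup α)} (h : ∀ s, f (of s) = g (of s)) : f = g := by
  have : f.toMonoidHom = g.toMonoidHom := by
    ext1 s
    exact h s
  exact MulEquiv.ext fun w => DFunLike.congr_fun this w

variable [DecidableEq α]

/-- The endomorphism of a free group with `s ↦ u * s * v` that fixes the other basis elements. -/
def transvectionHom (s : α) (u v : FreeGroup α) : FreeGroup α →* FreeGroup α :=
  lift (Function.update of s (u * of s * v))

theorem transvectionHom_of_self (s : α) (u v : FreeGroup α) :
    transvectionHom s u v (of s) = u * of s * v := by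
  simp [transvectionHom]

theorem transvectionHom_of_ne {s t : α} (h : t ≠ s) (u v : FreeGroup α) :
    transvectionHom s u v (of t) = of t := by
  simp [transvectionHom, h]

theorem transvectionHom_of_mem {s : α} {w : FreeGroup α} (hw : w ∈ avoiding s)
    (u v : FreeGroup α) : transvectionHom s u v w = w := by
  induction hw using Subgroup.closure_induction with
  | mem x hx =>
    obtain ⟨t, ht, rfl⟩ := hx
    exact transvectionHom_of_ne ht u v
  | one => exact map_one _
  | mul x y _ _ hx hy => rw [map_mul, hx, hy]
  | inv x _ hx => rw [map_inv, hx]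

theorem transvectionHom_comp {s : α} {u v u' v' : FreeGroup α} (hu' : u' ∈ avoiding s)
    (hv' : v' ∈ avoiding s) :
    (transvectionHom s u v).comp (transvectionHom s u' v') =
      transvectionHom s (u' * u) (v * v') := by
  ext1 t
  rcases eq_or_ne t s with rfl | h
  · simp only [MonoidHom.comp_apply, transvectionHom_of_self, map_mul,
      transvectionHom_of_mem hu', transvectionHom_of_mem hv', mul_assoc]
  · simp only [MonoidHom.comp_apply, transvectionHom_of_ne h]

theorem transvectionHom_one (s : α) : transvectionHom s 1 1 = MonoidHom.id _ := by
  ext1 t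
  rcases eq_or_ne t s with rfl | h
  · simp [transvectionHom_of_self]
  · simp [transvectionHom_of_ne h]

open Classical in
/-- The automorphism of a free group with `s ↦ u * s * v` that fixes the other basis elements,
where `u` and `v` are words in the other basis elements. If `u` or `v` involves `s`, this is the
identity by convention. -/
def transvection (s : α) (u v : FreeGroup α) : MulAut (FreeGroup α) :=
  if h : u ∈ avoiding s ∧ v ∈ avoiding s then
    MonoidHom.toMulEquiv (transvectionHom s u v) (transvectionHom s u⁻¹ v⁻¹)
      (by rw [transvectionHom_comp h.1 h.2, mul_inv_cancel, inv_mul_cancel, transvectionHom_one])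
      (by rw [transvectionHom_comp (inv_mem h.1) (inv_mem h.2), inv_mul_cancel, mul_inv_cancel,
        transvectionHom_one])
  else 1

theorem transvection_apply {s : α} {u v : FreeGroup α} (hu : u ∈ avoiding s)
    (hv : v ∈ avoiding s) (w : FreeGroup α) :
    transvection s u v w = transvectionHom s u v w := by
  rw [transvection, dif_pos ⟨hu, hv⟩]
  rfl

theorem transvection_of_self {s : α} {u v : FreeGroup α} (hu : u ∈ avoiding s)
    (hv : v ∈ avoiding s) : transvection s u v (of s) = u * of s * v := by
  rw [transvection_apply hu hv, transvectionHom_of_self]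

theorem transvection_of_mem {s : α} (u v : FreeGroup α) {w : FreeGroup α}
    (hw : w ∈ avoiding s) : transvection s u v w = w := by
  by_cases h : u ∈ avoiding s ∧ v ∈ avoiding s
  · rw [transvection_apply h.1 h.2, transvectionHom_of_mem hw]
  · rw [transvection, dif_neg h]
    rfl

theorem transvection_of_ne {s t : α} (u v : FreeGroup α) (h : t ≠ s) :
    transvection s u v (of t) = of t :=
  transvection_of_mem u v (of_mem_avoiding h)

theorem transvection_mul {s : α} {u v u' v' : FreeGroup α} (hu : u ∈ avoiding s)
    (hv : v ∈ avoiding s) (hu' : u' ∈ avoiding s) (hv' : v' ∈ avoiding s) :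
    transvection s u v * transvection s u' v' = transvection s (u' * u) (v * v') := by
  refine MulEquiv.ext fun w => ?_
  rw [MulAut.mul_apply, transvection_apply hu hv, transvection_apply hu' hv',
    transvection_apply (mul_mem hu' hu) (mul_mem hv hv'), ← MonoidHom.comp_apply,
    transvectionHom_comp hu' hv']

theorem transvection_one (s : α) : transvection s 1 1 = 1 := by
  refine mulAut_ext fun t => ?_
  rw [transvection_apply (one_mem _) (one_mem _), transvectionHom_one]
  rfl

theorem transvection_inv {s : α} {u v : FreeGroup α} (hu : u ∈ avoiding s)
    (hv : v ∈ avoiding s) : (transvection s u v)⁻¹ = transvection s u⁻¹ v⁻¹ := by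
  rw [inv_eq_iff_mul_eq_one, transvection_mul hu hv (inv_mem hu) (inv_mem hv), inv_mul_cancel,
    mul_inv_cancel, transvection_one]

/-- If `a` fixes `s` and preserves the subgroup generated by the other basis elements, then
conjugating a transvection by `a` applies `a` to the multipliers. -/
theorem mul_transvection {s : α} {a : MulAut (FreeGroup α)} (has : a (of s) = of s)
    (ha : ∀ t, t ≠ s → a (of t) ∈ avoiding s) {u v : FreeGroup α} (hu : u ∈ avoiding s)
    (hv : v ∈ avoiding s) :
    a * transvection s u v = transvection s (a u) (a v) * a := by
  have key : ∀ w ∈ avoiding s, a w ∈ avoiding s := by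
    intro w hw
    induction hw using Subgroup.closure_induction with
    | mem x hx =>
      obtain ⟨t, ht, rfl⟩ := hx
      exact ha t ht
    | one => rw [map_one]; exact one_mem _
    | mul x y _ _ hx hy => rw [map_mul]; exact mul_mem hx hy
    | inv x _ hx => rw [map_inv]; exact inv_mem hx
  refine mulAut_ext fun t => ?_
  rcases eq_or_ne t s with rfl | h
  · rw [MulAut.mul_apply, MulAut.mul_apply, transvection_of_self hu hv, has,
      transvection_of_self (key u hu) (key v hv), map_mul, map_mul, has]
  · rw [MulAut.mul_apply, MulAut.mul_apply, transvection_of_ne u v h,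
      transvection_of_mem _ _ (ha t h)]

/-- Transvections of distinct basis elements: moving one past the other applies it to the
multipliers, as long as neither has `s` as a letter of its multipliers. -/
theorem transvection_mul_transvection {r s : α} (hrs : r ≠ s) {u v u' v' : FreeGroup α}
    (hu' : u' ∈ avoiding s) (hv' : v' ∈ avoiding s) (hu : u ∈ avoiding s) (hv : v ∈ avoiding s) :
    transvection r u' v' * transvection s u v =
      transvection s (transvection r u' v' u) (transvection r u' v' v) *
        transvection r u' v' := by
  refine mul_transvection (transvection_of_ne _ _ hrs.symm) (fun t ht => ?_) hu hv
  rcases eq_or_ne t r with rfl | h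
  · by_cases h : u' ∈ avoiding t ∧ v' ∈ avoiding t
    · rw [transvection_of_self h.1 h.2]
      exact mul_mem (mul_mem hu' (of_mem_avoiding ht)) hv'
    · rw [transvection, dif_neg h]
      exact of_mem_avoiding ht
  · rw [transvection_of_ne _ _ h]
    exact of_mem_avoiding ht

/-- Transvections of distinct basis elements commute if both multipliers avoid both of them. -/
theorem transvection_comm {r s : α} (hrs : r ≠ s) {u v u' v' : FreeGroup α}
    (hu's : u' ∈ avoiding s) (hv's : v' ∈ avoiding s)
    (hu : u ∈ avoiding s) (hv : v ∈ avoiding s) (hur : u ∈ avoiding r) (hvr : v ∈ avoiding r) :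
    transvection r u' v' * transvection s u v = transvection s u v * transvection r u' v' := by
  rw [transvection_mul_transvection hrs hu's hv's hu hv, transvection_of_mem _ _ hur,
    transvection_of_mem _ _ hvr]

end Transvection

/-! ### Nielsen reduced automorphisms of a free group -/

section NielsenReduced

variable {α : Type*}

/-- The inverse of a letter, where a letter is a basis element or the inverse of one. -/
def letterInv (t : α × Bool) : α × Bool := (t.1, !t.2)

theorem letterInv_letterInv (t : α × Bool) : letterInv (letterInv t) = t := by
  simp [letterInv]

theorem letterInv_ne (t : α × Bool) : letterInv t ≠ t := fun h => by
  simpa [letterInv] using congrArg Prod.snd h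

theorem eq_or_eq_letterInv {t r : α × Bool} (h : r.1 = t.1) : r = t ∨ r = letterInv t := by
  obtain ⟨a, b⟩ := t
  obtain ⟨a', b'⟩ := r
  obtain rfl : a' = a := h
  cases b <;> cases b' <;> simp [letterInv]

theorem mk_letterInv (t : α × Bool) : mk [letterInv t] = (mk [t])⁻¹ := rfl

theorem invRev_singleton (t : α × Bool) : invRev [t] = [letterInv t] := rfl

theorem mk_append (L M : List (α × Bool)) : mk (L ++ M) = mk L * mk M := rfl

theorem mk_invRev (L : List (α × Bool)) : mk (invRev L) = (mk L)⁻¹ := rfl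

theorem mk_injective_letter {t r : α × Bool} (h : mk [t] = mk [r]) : t = r := by
  classical
  have := congrArg toWord h
  simpa [toWord_mk, reduce_singleton] using this

theorem mk_singleton_ne_one (t : α × Bool) : mk [t] ≠ 1 := by
  classical
  intro h
  have := congrArg toWord h
  simp [toWord_mk] at this

/-- A letter is a letter of the basis element `t.1`. -/
theorem mk_singleton_eq (t : α × Bool) :
    mk [t] = of t.1 ∨ mk [t] = (of t.1)⁻¹ := by
  obtain ⟨a, b⟩ := t
  cases b
  · exact Or.inr rfl
  · exact Or.inl rfl

theorem exists_longest_common_prefix {γ : Type*} (a b : List γ) :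
    ∃ p a' b', a = p ++ a' ∧ b = p ++ b' ∧ ∀ x ∈ a'.head?, ∀ y ∈ b'.head?, x ≠ y := by
  induction a generalizing b with
  | nil => exact ⟨[], [], b, rfl, rfl, by simp⟩
  | cons x a ih =>
    rcases b with _ | ⟨y, b⟩
    · exact ⟨[], x :: a, [], rfl, rfl, by simp⟩
    · by_cases h : x = y
      · obtain ⟨p, a', b', rfl, rfl, hne⟩ := ih b
        exact ⟨x :: p, a', b', rfl, by simp [h], hne⟩
      · exact ⟨[], x :: a, y :: b, rfl, rfl, by simpa using h⟩

variable [DecidableEq α]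

/-- The reduced word of the image of a letter. -/
def imageWord (f : MulAut (FreeGroup α)) (t : α × Bool) : List (α × Bool) := (f (mk [t])).toWord

theorem mk_imageWord (f : MulAut (FreeGroup α)) (t : α × Bool) :
    mk (imageWord f t) = f (mk [t]) := mk_toWord

theorem imageWord_letterInv (f : MulAut (FreeGroup α)) (t : α × Bool) :
    imageWord f (letterInv t) = invRev (imageWord f t) := by
  rw [imageWord, mk_letterInv, map_inv, toWord_inv, imageWord]

theorem isReduced_imageWord (f : MulAut (FreeGroup α)) (t : α × Bool) :
    IsReduced (imageWord f t) := isReduced_toWord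

/-- The images of the letters are Nielsen reduced: in a product of images of letters, the two
neighbours of a factor never cancel all of it. -/
def NielsenReduced (f : MulAut (FreeGroup α)) : Prop :=
  ∀ (t r d : α × Bool) (p q : List (α × Bool)), r ≠ t → d ≠ letterInv t →
    p <+: imageWord f t → p <+: imageWord f r →
    q <+: imageWord f (letterInv t) → q <+: imageWord f d →
    p.length + q.length < (imageWord f t).length

/-- In the reduced form of a product of images of letters, each factor but the last contributes
at least one letter in front of what remains of the last factor. -/
theorem NielsenReduced.exists_toWord_eq {f : MulAut (FreeGroup α)} (hf : NielsenReduced f)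
    (l : List (α × Bool)) (t : α × Bool) (hl : IsReduced (l ++ [t])) :
    ∃ (z : List (α × Bool)) (c : ℕ) (r : α × Bool), r ≠ t ∧
      (imageWord f t).take c <+: imageWord f r ∧ c ≤ (imageWord f t).length ∧
      (f (mk (l ++ [t]))).toWord = z ++ (imageWord f t).drop c ∧ l.length ≤ z.length := by
  induction l using List.reverseRecOn generalizing t with
  | nil => exact ⟨[], 0, letterInv t, letterInv_ne t, by simp, by simp, by simp [imageWord], by simp⟩
  | append_singleton l s ih =>
    obtain ⟨z, c, r, hrs, hcr, hc, hz, hlz⟩ := ih s (hl.infix ⟨[], [t], by simp⟩)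
    have hts : t ≠ letterInv s := by
      rintro rfl
      have h2 : IsReduced [s, letterInv s] := hl.infix ⟨l, [], by simp⟩
      rw [isReduced_cons_cons] at h2
      simpa [letterInv] using h2.1 rfl
    obtain ⟨p, e, e', hp, hp', hne⟩ :=
      exists_longest_common_prefix (imageWord f (letterInv s)) (imageWord f t)
    have hs : imageWord f s = invRev e ++ invRev p := by
      rw [← invRev_append, ← hp, imageWord_letterInv, invRev_invRev]
    have hlen := hf s r t _ p hrs hts (List.take_prefix c _) hcr ⟨e, hp.symm⟩ ⟨e', hp'.symm⟩
    rw [List.length_take, min_eq_left hc] at hlen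
    have hlen' : c < (invRev e).length := by
      rw [hs, List.length_append, invRev_length, invRev_length] at hlen
      rw [invRev_length]
      omega
    set m := (invRev e).drop c with hm
    have hmne : m ≠ [] := by
      rw [hm, Ne, List.drop_eq_nil_iff]
      omega
    have hdrop : (imageWord f s).drop c = m ++ invRev p := by
      rw [hs, List.drop_append_of_le_length hlen'.le]
    refine ⟨z ++ m, p.length, letterInv s, hts.symm, ?_, ?_, ?_, ?_⟩
    · rw [hp', List.take_left']
      · exact ⟨e, hp.symm⟩
      · rfl
    · rw [hp', List.length_append]
      omega
    · have hred : IsReduced (z ++ m ++ e') := by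
        refine IsReduced.append_overlap ?_ ?_ hmne
        · refine (isReduced_toWord (x := f (mk (l ++ [s])))).infix ⟨[], invRev p, ?_⟩
          rw [hz, hdrop]
          simp
        · refine List.IsChain.append ?_ ?_ ?_
          · refine (isReduced_imageWord f s).infix ⟨(invRev e).take c, invRev p, ?_⟩
            rw [hm, List.take_append_drop, hs]
          · refine (isReduced_imageWord f t).infix ⟨p, [], ?_⟩
            rw [hp', List.append_nil]
          · intro a ha b hb hab
            have ha' : (invRev e).getLast? = some a := by
              rw [← List.take_append_drop c (invRev e), ← hm, List.getLast?_append_of_ne_nil _ hmne]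
              exact ha
            have hea : e.head? = some (letterInv a) := by
              rcases e with _ | ⟨x, e⟩
              · simp at ha'
              · rw [invRev_cons, invRev_singleton, List.getLast?_concat] at ha'
                obtain rfl : letterInv x = a := by simpa using ha'
                rw [letterInv_letterInv]
                rfl
            rcases eq_or_eq_letterInv hab.symm with h | h
            · rw [h]
            · exact absurd h.symm (hne _ hea _ hb)
      have hprod : f (mk (l ++ [s] ++ [t])) = mk (z ++ m ++ e') := by
        have h1 : f (mk (l ++ [s])) = mk (z ++ (m ++ invRev p)) := by
          rw [← hdrop, ← hz, mk_toWord]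
        rw [mk_append, map_mul, h1, ← mk_imageWord f t, hp']
        simp only [mk_append, mk_invRev]
        group
      rw [hprod, toWord_mk, hred.reduce_eq, hp', List.drop_left']
      rfl
    · rw [List.length_append, List.length_append, List.length_singleton]
      have := List.length_pos_of_ne_nil hmne
      omega

theorem NielsenReduced.norm_le {f : MulAut (FreeGroup α)} (hf : NielsenReduced f)
    (w : FreeGroup α) : w.norm ≤ (f w).norm := by
  rcases List.eq_nil_or_concat w.toWord with h | ⟨l, t, h⟩
  · rw [FreeGroup.norm, h]
    exact Nat.zero_le _
  · rw [List.concat_eq_append] at h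
    have hl : IsReduced (l ++ [t]) := h ▸ isReduced_toWord
    obtain ⟨z, c, r, hrt, hcr, hc, hz, hlz⟩ := hf.exists_toWord_eq l t hl
    rw [← h, mk_toWord] at hz
    have hlen := hf t r t _ [] hrt (letterInv_ne t).symm (List.take_prefix c _) hcr
      List.nil_prefix List.nil_prefix
    rw [List.length_take, min_eq_left hc, List.length_nil, add_zero] at hlen
    rw [FreeGroup.norm, FreeGroup.norm, hz, h, List.length_append, List.length_append, List.length_drop,
      List.length_singleton]
    omega

/-- The inverse of a Nielsen reduced automorphism permutes the letters. -/
theorem NielsenReduced.exists_inv_apply_eq {f : MulAut (FreeGroup α)} (hf : NielsenReduced f)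
    (t : α × Bool) : ∃ r, f⁻¹ (mk [t]) = mk [r] := by
  have h1 : (f⁻¹ (mk [t])).norm ≤ 1 := by
    refine (hf.norm_le _).trans ?_
    rw [MulAut.apply_inv_self]
    exact norm_mk_le
  have h2 : f⁻¹ (mk [t]) ≠ 1 := fun h => mk_singleton_ne_one t (by
    rw [← MulAut.apply_inv_self _ f (mk [t]), h, map_one])
  have h3 : (f⁻¹ (mk [t])).norm = 1 :=
    le_antisymm h1 (Nat.one_le_iff_ne_zero.mpr (mt norm_eq_zero.mp h2))
  obtain ⟨r, hr⟩ := List.length_eq_one_iff.mp h3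
  exact ⟨r, by rw [← hr, mk_toWord]⟩

end NielsenReduced

/-! ### The complexity of an automorphism -/

section Complexity

variable {α : Type*} [Fintype α]

/-- The word `L` read as a numeral, with the first letter as the most significant digit. The base
exceeds all digits, and is at least `2` even for an empty alphabet. -/
def wordCode (L : List (α × Bool)) : ℕ :=
  Nat.ofDigits (Fintype.card (α × Bool) + 2)
    (L.reverse.map fun t => (Fintype.equivFin (α × Bool) t : ℕ))

theorem wordCode_append (L M : List (α × Bool)) :
    wordCode (L ++ M) =
      wordCode M + (Fintype.card (α × Bool) + 2) ^ M.length * wordCode L := by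
  rw [wordCode, List.reverse_append, List.map_append, Nat.ofDigits_append, List.length_map,
    List.length_reverse]
  rfl

theorem wordCode_append_lt {p q : List (α × Bool)} (h : wordCode q < wordCode p)
    (r : List (α × Bool)) : wordCode (q ++ r) < wordCode (p ++ r) := by
  rw [wordCode_append, wordCode_append]
  gcongr

theorem wordCode_inj {p q : List (α × Bool)} (hl : p.length = q.length)
    (h : wordCode p = wordCode q) : p = q := by
  have hd : ∀ L : List (α × Bool), ∀ d ∈ L.reverse.map
      fun t => (Fintype.equivFin (α × Bool) t : ℕ), d < Fintype.card (α × Bool) + 2 := by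
    intro L d hd
    obtain ⟨t, -, rfl⟩ := List.mem_map.mp hd
    exact (Fintype.equivFin (α × Bool) t).2.trans (by omega)
  have := Nat.ofDigits_inj_of_len_eq (by omega) (by simpa using hl) (hd p) (hd q) h
  refine List.reverse_injective (List.map_injective_iff.mpr ?_ this)
  exact Fin.val_injective.comp (Fintype.equivFin _).injective

/-- The sum of the codes of the initial halves of a word and of its inverse. A middle letter
belongs to neither half. -/
def halvesCode (L : List (α × Bool)) : ℕ :=
  wordCode (L.take (L.length / 2)) + wordCode ((invRev L).take (L.length / 2))

theorem halvesCode_invRev (L : List (α × Bool)) : halvesCode (invRev L) = halvesCode L := by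
  rw [halvesCode, halvesCode, invRev_invRev, invRev_length, add_comm]

variable [DecidableEq α]

/-- The comparison of elements of a free group by word length, and by the codes of the halves of
the reduced words if the lengths agree. -/
def Lighter (v w : FreeGroup α) : Prop :=
  v.norm < w.norm ∨ v.norm = w.norm ∧ halvesCode v.toWord < halvesCode w.toWord

theorem Lighter.inv {v w : FreeGroup α} (h : Lighter v w) : Lighter v⁻¹ w⁻¹ := by
  simpa only [Lighter, norm_inv_eq, toWord_inv, halvesCode_invRev] using h

theorem lighter_mk_of_length_lt {L : List (α × Bool)} {w : FreeGroup α}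
    (h : L.length < w.toWord.length) : Lighter (mk L) w :=
  Or.inl (norm_mk_le.trans_lt h)

/-- The word `L` need not be reduced: if it is not, then `mk L` is shorter. -/
theorem lighter_mk {L : List (α × Bool)} {w : FreeGroup α} (hl : L.length = w.toWord.length)
    (h : halvesCode L < halvesCode w.toWord) : Lighter (mk L) w := by
  have h1 : (mk L).norm ≤ w.norm := norm_mk_le.trans_eq hl
  rcases h1.lt_or_eq with h2 | h2
  · exact Or.inl h2
  · refine Or.inr ⟨h2, ?_⟩
    have h3 : (mk L).toWord = L := by
      rw [toWord_mk]
      exact ((Red.sublist reduce.red).eq_of_length (by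
        rw [← toWord_mk]; exact h2.trans hl.symm))
    rwa [h3]

/-- The measure that decreases in Nielsen reduction: the total length of the images of the basis
elements, and then the total code of the halves of these images. -/
def complexity (f : MulAut (FreeGroup α)) : ℕ ×ₗ ℕ :=
  toLex (∑ s, (f (of s)).norm, ∑ s, halvesCode (f (of s)).toWord)

theorem complexity_lt {f g : MulAut (FreeGroup α)} {s : α} (hs : Lighter (f (of s)) (g (of s)))
    (h : ∀ t, t ≠ s → f (of t) = g (of t)) : complexity f < complexity g := by
  have key : ∀ φ : FreeGroup α → ℕ, φ (f (of s)) < φ (g (of s)) →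
      ∑ t, φ (f (of t)) < ∑ t, φ (g (of t)) := fun φ hφ => by
    refine Finset.sum_lt_sum (fun t _ => ?_) ⟨s, Finset.mem_univ s, hφ⟩
    rcases eq_or_ne t s with rfl | ht
    · exact hφ.le
    · rw [h t ht]
  rw [complexity, complexity, Prod.Lex.toLex_lt_toLex]
  rcases hs with hs | ⟨hs, hs'⟩
  · exact Or.inl (key norm hs)
  · refine Or.inr ⟨Finset.sum_congr rfl fun t _ => ?_, key (fun w => halvesCode w.toWord) hs'⟩
    rcases eq_or_ne t s with rfl | ht
    · exact hs
    · rw [h t ht]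

end Complexity

/-! ### Elementary automorphisms and Nielsen reduction -/

section Elementary

variable {α : Type*}

theorem mk_mem_avoiding {r : α × Bool} {s : α} (h : r.1 ≠ s) : mk [r] ∈ avoiding s := by
  rcases mk_singleton_eq r with h' | h' <;> rw [h']
  · exact of_mem_avoiding h
  · exact inv_mem (of_mem_avoiding h)

/-- The automorphism `f` maps every basis element in `V` to a conjugate of itself. -/
def ConjugatesBasis (V : Set α) (f : MulAut (FreeGroup α)) : Prop :=
  ∀ s ∈ V, ∃ g, f (of s) = g * of s * g⁻¹

theorem ConjugatesBasis.mul {V : Set α} {f g : MulAut (FreeGroup α)} (hf : ConjugatesBasis V f)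
    (hg : ConjugatesBasis V g) : ConjugatesBasis V (f * g) := by
  intro s hs
  obtain ⟨a, ha⟩ := hf s hs
  obtain ⟨b, hb⟩ := hg s hs
  refine ⟨f b * a, ?_⟩
  rw [MulAut.mul_apply, hb, map_mul, map_mul, map_inv, ha]
  group

variable [DecidableEq α]

/-- The elementary automorphisms relative to a set `V` of basis elements: a basis element outside
`V` is multiplied by a letter on the left or on the right, and a basis element in `V` is conjugated
by a letter. -/
def elementaryAut (V : Set α) : Set (MulAut (FreeGroup α)) :=
  {g | ∃ (s : α) (r : α × Bool), r.1 ≠ s ∧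
    ((s ∉ V ∧ (g = transvection s (mk [r]) 1 ∨ g = transvection s 1 (mk [r]))) ∨
      (s ∈ V ∧ g = transvection s (mk [r]) (mk [r])⁻¹))}

theorem inv_mem_elementaryAut {V : Set α} {g : MulAut (FreeGroup α)} (hg : g ∈ elementaryAut V) :
    g⁻¹ ∈ elementaryAut V := by
  obtain ⟨s, r, hr, h⟩ := hg
  have hm := mk_mem_avoiding hr
  refine ⟨s, letterInv r, hr, ?_⟩
  rw [mk_letterInv]
  rcases h with ⟨hs, rfl | rfl⟩ | ⟨hs, rfl⟩
  · rw [transvection_inv hm (one_mem _), inv_one]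
    exact Or.inl ⟨hs, Or.inl rfl⟩
  · rw [transvection_inv (one_mem _) hm, inv_one]
    exact Or.inl ⟨hs, Or.inr rfl⟩
  · rw [transvection_inv hm (inv_mem hm)]
    exact Or.inr ⟨hs, rfl⟩

theorem conjugatesBasis_of_mem_elementaryAut {V : Set α} {g : MulAut (FreeGroup α)}
    (hg : g ∈ elementaryAut V) : ConjugatesBasis V g := by
  intro t ht
  obtain ⟨s, r, hr, h⟩ := hg
  have hm := mk_mem_avoiding hr
  rcases eq_or_ne t s with rfl | hts
  · rcases h with ⟨hs, -⟩ | ⟨hs, rfl⟩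
    · exact absurd ht hs
    · exact ⟨mk [r], transvection_of_self hm (inv_mem hm)⟩
  · refine ⟨1, ?_⟩
    rcases h with ⟨hs, rfl | rfl⟩ | ⟨hs, rfl⟩ <;> simp [transvection_of_ne _ _ hts]

/-- The reduced word of a conjugate of a letter is a palindrome up to inversion. -/
theorem exists_toWord_conj (t : α × Bool) (g : FreeGroup α) :
    ∃ h, (g * mk [t] * g⁻¹).toWord = h ++ [t] ++ invRev h := by
  rw [← mk_toWord (x := g)]
  induction g.toWord with
  | nil => exact ⟨[], by rw [← one_eq_mk, one_mul, inv_one, mul_one, toWord_mk, reduce_singleton]; rfl⟩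
  | cons a L ih =>
    obtain ⟨h, hh⟩ := ih
    have hred : IsReduced (h ++ [t] ++ invRev h) := hh ▸ isReduced_toWord
    have hmk : mk (a :: L) * mk [t] * (mk (a :: L))⁻¹ =
        mk [a] * mk (h ++ [t] ++ invRev h) * (mk [a])⁻¹ := by
      rw [← hh, mk_toWord, ← List.singleton_append, mk_append]
      group
    rw [hmk]
    rcases h with _ | ⟨b, h⟩
    · by_cases hat : a.1 = t.1
      · refine ⟨[], ?_⟩
        have : mk [a] * mk ([] ++ [t] ++ invRev []) * (mk [a])⁻¹ = mk [t] := by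
          rcases eq_or_eq_letterInv hat with rfl | rfl
          · exact mul_inv_cancel_right (mk [a]) (mk [a])
          · rw [mk_letterInv, inv_inv]
            exact (congrArg (· * mk [t]) (inv_mul_cancel (mk [t]))).trans (one_mul _)
        rw [this, toWord_mk, reduce_singleton]
        rfl
      · refine ⟨[a], ?_⟩
        change (mk ([a] ++ [t] ++ invRev [a])).toWord = _
        rw [toWord_mk, IsReduced.reduce_eq]
        simp [invRev_singleton, letterInv, hat, Ne.symm hat]
    · by_cases hab : a = letterInv b
      · refine ⟨h, ?_⟩
        have : mk [a] * mk (b :: h ++ [t] ++ invRev (b :: h)) * (mk [a])⁻¹ =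
            mk (h ++ [t] ++ invRev h) := by
          rw [← List.singleton_append (l := h), hab, mk_letterInv]
          simp only [mk_append, mk_invRev]
          group
        rw [this, toWord_mk, IsReduced.reduce_eq]
        refine hred.infix ⟨[b], [letterInv b], ?_⟩
        rw [invRev_cons, invRev_singleton]
        simp
      · refine ⟨a :: b :: h, ?_⟩
        have : mk [a] * mk (b :: h ++ [t] ++ invRev (b :: h)) * (mk [a])⁻¹ =
            mk (a :: b :: h ++ [t] ++ invRev (a :: b :: h)) := by
          change _ = mk ([a] ++ (b :: h) ++ [t] ++ invRev ([a] ++ (b :: h)))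
          simp only [mk_append, mk_invRev]
          group
        have hab' : IsReduced [a, b] := by
          rw [isReduced_cons_cons]
          refine ⟨fun h1 => ?_, IsReduced.singleton⟩
          rcases eq_or_eq_letterInv h1 with h2 | h2
          · rw [h2]
          · exact absurd h2 hab
        rw [this, toWord_mk, IsReduced.reduce_eq]
        have h1 : IsReduced (a :: (b :: h ++ [t] ++ invRev (b :: h))) :=
          IsReduced.append_overlap (L₁ := [a]) (L₂ := [b]) hab' hred (by simp)
        have h2 := IsReduced.append_overlap (L₁ := a :: (b :: h ++ [t] ++ invRev h))
          (L₂ := [letterInv b]) (L₃ := [letterInv a]) ?_ ?_ (by simp)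
        · rw [invRev_cons (a := a), invRev_cons (a := b), invRev_singleton, invRev_singleton]
          simpa using h2
        · rw [invRev_cons (a := b), invRev_singleton] at h1
          simpa using h1
        · rw [List.singleton_append, isReduced_cons_cons] at *
          refine ⟨fun h3 => ?_, IsReduced.singleton⟩
          simpa [letterInv] using (hab'.1 h3.symm).symm

theorem exists_imageWord_eq {V : Set α} {f : MulAut (FreeGroup α)} (hf : ConjugatesBasis V f)
    {t : α × Bool} (ht : t.1 ∈ V) : ∃ h, imageWord f t = h ++ [t] ++ invRev h := by
  obtain ⟨g, hg⟩ := hf t.1 ht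
  have : f (mk [t]) = g * mk [t] * g⁻¹ := by
    rcases mk_singleton_eq t with h | h <;> rw [h]
    · exact hg
    · rw [map_inv, hg]
      group
  obtain ⟨h, hh⟩ := exists_toWord_conj t g
  exact ⟨h, by rw [imageWord, this, hh]⟩

end Elementary

section Reduction

variable {α : Type*} [DecidableEq α]

/-- A reduced word and its inverse share at most the first half of their letters, as the middle
letters would otherwise cancel. -/
theorem two_mul_length_le_of_prefix_invRev {L p : List (α × Bool)} (hL : IsReduced L)
    (h1 : p <+: L) (h2 : p <+: invRev L) : 2 * p.length ≤ L.length := by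
  by_contra! hlt
  obtain ⟨a, rfl⟩ := h1
  rw [List.length_append] at hlt
  rw [invRev_append] at h2
  obtain ⟨p₂, rfl⟩ := List.prefix_of_prefix_length_le (List.prefix_append (invRev a) (invRev p)) h2
    (by rw [invRev_length]; omega)
  rw [List.prefix_append_right_inj, invRev_append, invRev_invRev] at h2
  have h3 : p₂ = invRev p₂ :=
    (List.prefix_of_prefix_length_le h2 (List.prefix_append _ _) (by rw [invRev_length])).eq_of_length
      (by rw [invRev_length])
  have h4 : mk p₂ = 1 := by
    rw [← self_eq_inv, ← mk_invRev, ← h3]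
  have h5 : IsReduced p₂ := hL.infix ⟨invRev a, a, by simp⟩
  have h6 : p₂ = [] := by
    rw [← h5.reduce_eq, ← toWord_mk, h4, toWord_one]
  rw [h6, List.length_append, invRev_length, List.length_nil] at hlt
  omega

variable [Fintype α]

/-- Some elementary automorphism reduces the complexity of `f`. -/
def HasReduction (V : Set α) (f : MulAut (FreeGroup α)) : Prop :=
  ∃ m ∈ elementaryAut V, complexity (f * m) < complexity f

variable {V : Set α} {f : MulAut (FreeGroup α)}

theorem hasReduction_of_left {t r : α × Bool} (ht : t.1 ∉ V) (hr : r.1 ≠ t.1)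
    (h : Lighter (f (mk [r]) * f (mk [t])) (f (mk [t]))) : HasReduction V f := by
  obtain ⟨s, b⟩ := t
  have hm := mk_mem_avoiding hr
  cases b
  · have hs : mk [(s, false)] = (of s)⁻¹ := rfl
    refine ⟨transvection s 1 (mk [letterInv r]),
      ⟨s, letterInv r, hr, Or.inl ⟨ht, Or.inr rfl⟩⟩, complexity_lt (s := s) ?_ fun t ht => ?_⟩
    · rw [MulAut.mul_apply, mk_letterInv, transvection_of_self (one_mem _) (inv_mem hm), one_mul,
        map_mul, map_inv]
      rw [hs] at h
      simpa using h.inv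
    · rw [MulAut.mul_apply, transvection_of_ne _ _ ht]
  · refine ⟨transvection s (mk [r]) 1,
      ⟨s, r, hr, Or.inl ⟨ht, Or.inl rfl⟩⟩, complexity_lt (s := s) ?_ fun t ht => ?_⟩
    · rw [MulAut.mul_apply, transvection_of_self hm (one_mem _), mul_one, map_mul]
      exact h
    · rw [MulAut.mul_apply, transvection_of_ne _ _ ht]

theorem hasReduction_of_conj {t r : α × Bool} (ht : t.1 ∈ V) (hr : r.1 ≠ t.1)
    (h : Lighter (f (mk [r]) * f (mk [t]) * (f (mk [r]))⁻¹) (f (mk [t]))) : HasReduction V f := by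
  have hm := mk_mem_avoiding hr
  refine ⟨transvection t.1 (mk [r]) (mk [r])⁻¹,
    ⟨t.1, r, hr, Or.inr ⟨ht, rfl⟩⟩, complexity_lt (s := t.1) ?_ fun t ht => ?_⟩
  · rw [MulAut.mul_apply, transvection_of_self hm (inv_mem hm), map_mul, map_mul, map_inv]
    rcases mk_singleton_eq t with h' | h' <;> rw [h'] at h
    · exact h
    · simpa [mul_assoc] using h.inv
  · rw [MulAut.mul_apply, transvection_of_ne _ _ ht]

/-- If the conjugator of one conjugate of a basis element starts with a longer initial part of
another conjugate, then conjugation shortens the former. -/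
theorem hasReduction_of_prefix_conjugator {t r : α × Bool} (ht : t.1 ∈ V) (hr : r.1 ≠ t.1)
    {g h : List (α × Bool)} (hg : imageWord f t = g ++ [t] ++ invRev g)
    (hh : imageWord f r = h ++ [r] ++ invRev h) (hp : h ++ [r] <+: g) : HasReduction V f := by
  obtain ⟨g', rfl⟩ := hp
  refine hasReduction_of_conj (r := letterInv r) ht hr ?_
  rw [mk_letterInv, map_inv, ← mk_imageWord f t, ← mk_imageWord f r]
  have : (mk (imageWord f r))⁻¹ * mk (imageWord f t) * (mk (imageWord f r))⁻¹⁻¹ =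
      mk (h ++ g' ++ [t] ++ invRev (h ++ g')) := by
    rw [hg, hh]
    simp only [mk_append, mk_invRev]
    group
  rw [this]
  refine lighter_mk_of_length_lt ?_
  rw [toWord_mk, (isReduced_imageWord f t).reduce_eq, hg]
  simp only [List.length_append, invRev_length, List.length_singleton]
  omega

/-- If the images of two letters share more than half of the first one, then there is a reduction. -/
theorem hasReduction_of_long_prefix (hf : ConjugatesBasis V f) {t r : α × Bool} (hrt : r ≠ t)
    {p : List (α × Bool)} (hpt : p <+: imageWord f t) (hpr : p <+: imageWord f r)
    (hlt : (imageWord f t).length < 2 * p.length) : HasReduction V f := by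
  by_cases hr : r.1 = t.1
  · obtain rfl := (eq_or_eq_letterInv hr).resolve_left hrt
    rw [imageWord_letterInv] at hpr
    exact absurd (two_mul_length_le_of_prefix_invRev (isReduced_imageWord f t) hpt hpr)
      (by omega)
  obtain ⟨a, ha⟩ := hpt
  obtain ⟨b, hb⟩ := hpr
  have hlt' : a.length < p.length := by
    rw [← ha, List.length_append] at hlt
    omega
  have hWt : (f (mk [t])).toWord = p ++ a := ha.symm
  have hWr : (f (mk [r])).toWord = p ++ b := hb.symm
  by_cases hrV : r.1 ∈ V
  swap
  · refine hasReduction_of_left (r := letterInv t) hrV (Ne.symm hr) ?_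
    have : f (mk [letterInv t]) * f (mk [r]) = mk (invRev a ++ b) := by
      rw [mk_letterInv, map_inv, ← mk_imageWord f t, ← mk_imageWord f r, ← ha, ← hb]
      simp only [mk_append, mk_invRev]
      group
    rw [this]
    refine lighter_mk_of_length_lt ?_
    rw [hWr, List.length_append, List.length_append, invRev_length]
    omega
  obtain ⟨h, hh⟩ := exists_imageWord_eq hf hrV
  have hlen : p.length + b.length = 2 * h.length + 1 := by
    have := congrArg List.length hh
    rw [← hb] at this
    simp only [List.length_append, invRev_length, List.length_singleton] at this
    omega
  rcases le_or_gt p.length h.length with hle | hgt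
  · obtain ⟨h', rfl⟩ : p <+: h := List.prefix_of_prefix_length_le ⟨b, hb⟩
      (by rw [hh, List.append_assoc]; exact List.prefix_append _ _) hle
    refine hasReduction_of_conj (r := letterInv t) hrV (Ne.symm hr) ?_
    have : f (mk [letterInv t]) * f (mk [r]) * (f (mk [letterInv t]))⁻¹ =
        mk (invRev a ++ h' ++ [r] ++ invRev (invRev a ++ h')) := by
      rw [mk_letterInv, map_inv, ← mk_imageWord f t, ← mk_imageWord f r, ← ha, hh]
      simp only [mk_append, mk_invRev]
      group
    rw [this]
    refine lighter_mk_of_length_lt ?_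
    rw [hWr]
    simp only [List.length_append, invRev_length, List.length_singleton] at hlen ⊢
    omega
  by_cases htV : t.1 ∈ V
  swap
  · refine hasReduction_of_left (r := letterInv r) htV hr ?_
    have : f (mk [letterInv r]) * f (mk [t]) = mk (invRev b ++ a) := by
      rw [mk_letterInv, map_inv, ← mk_imageWord f t, ← mk_imageWord f r, ← ha, ← hb]
      simp only [mk_append, mk_invRev]
      group
    rw [this]
    refine lighter_mk_of_length_lt ?_
    rw [hWt, List.length_append, List.length_append, invRev_length]
    omega
  obtain ⟨g, hg⟩ := exists_imageWord_eq hf htV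
  have hlen' : p.length + a.length = 2 * g.length + 1 := by
    have := congrArg List.length hg
    rw [← ha] at this
    simp only [List.length_append, invRev_length, List.length_singleton] at this
    omega
  -- Both images now start with `p`, which contains their middle letters.
  have hhp : h ++ [r] <+: p := List.prefix_of_prefix_length_le
    (l₃ := imageWord f r) (by rw [hh]; exact List.prefix_append _ _) ⟨b, hb⟩ (by simpa using hgt)
  have hgp : g ++ [t] <+: p := List.prefix_of_prefix_length_le
    (l₃ := imageWord f t) (by rw [hg]; exact List.prefix_append _ _) ⟨a, ha⟩
    (by rw [List.length_append, List.length_singleton]; omega)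
  rcases lt_trichotomy h.length g.length with hl | hl | hl
  · exact hasReduction_of_prefix_conjugator htV hr hg hh
      (List.prefix_of_prefix_length_le hhp ((List.prefix_append _ _).trans hgp) (by simpa using hl))
  · have h1 : h ++ [r] = g ++ [t] :=
      (List.prefix_of_prefix_length_le hhp hgp (by simp [hl])).eq_of_length (by simp [hl])
    have h2 := (List.append_inj h1 hl).2
    exact absurd (congrArg Prod.fst (List.singleton_inj.mp h2)) hr
  · exact hasReduction_of_prefix_conjugator hrV (Ne.symm hr) hh hg
      (List.prefix_of_prefix_length_le hgp ((List.prefix_append _ _).trans hhp) (by simpa using hl))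

/-- If the image of a letter `t` has halves `p` and `invRev q`, where `q` has the smaller code, and
the image of another letter starts with `p`, then replacing this `p` by `q` is a reduction. -/
theorem hasReduction_of_half (hf : ConjugatesBasis V f) {t r : α × Bool} (hr : r.1 ≠ t.1)
    {p q : List (α × Bool)} (hpq : imageWord f t = p ++ invRev q) (hl : p.length = q.length)
    (hpr : p <+: imageWord f r) (hlt : wordCode q < wordCode p) : HasReduction V f := by
  have hne : r ≠ t := fun h => hr (congrArg Prod.fst h)
  by_cases hlong : (imageWord f r).length < 2 * p.length
  · exact hasReduction_of_long_prefix hf hne.symm hpr ⟨_, hpq.symm⟩ hlong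
  obtain ⟨b, hb⟩ := hpr
  have hWr : (f (mk [r])).toWord = p ++ b := hb.symm
  rw [← hb, List.length_append] at hlong
  by_cases hrV : r.1 ∈ V
  · obtain ⟨h, hh⟩ := exists_imageWord_eq hf hrV
    have hlen : p.length + b.length = 2 * h.length + 1 := by
      have := congrArg List.length hh
      rw [← hb] at this
      simp only [List.length_append, invRev_length, List.length_singleton] at this
      omega
    obtain ⟨h', rfl⟩ : p <+: h := List.prefix_of_prefix_length_le ⟨b, hb⟩
      (by rw [hh, List.append_assoc]; exact List.prefix_append _ _) (by omega)
    refine hasReduction_of_conj (r := letterInv t) hrV (Ne.symm hr) ?_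
    have : f (mk [letterInv t]) * f (mk [r]) * (f (mk [letterInv t]))⁻¹ =
        mk (q ++ h' ++ [r] ++ invRev (q ++ h')) := by
      rw [mk_letterInv, map_inv, ← mk_imageWord f t, ← mk_imageWord f r, hpq, hh]
      simp only [mk_append, mk_invRev]
      group
    have hcode : ∀ L : List (α × Bool), halvesCode (L ++ [r] ++ invRev L) = 2 * wordCode L := by
      intro L
      have h1 : (L ++ [r] ++ invRev L).length / 2 = L.length := by
        simp only [List.length_append, invRev_length, List.length_singleton]
        omega
      rw [halvesCode, h1, invRev_append, invRev_append, invRev_invRev, List.append_assoc,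
        List.take_left' rfl, List.take_left' rfl, two_mul]
    have hWr' : (f (mk [r])).toWord = p ++ h' ++ [r] ++ invRev (p ++ h') := hh
    rw [this]
    refine lighter_mk ?_ ?_
    · rw [hWr']
      simp only [List.length_append, invRev_length, List.length_singleton, hl]
    · rw [hWr', hcode, hcode]
      have := wordCode_append_lt hlt h'
      omega
  · refine hasReduction_of_left (r := letterInv t) hrV (Ne.symm hr) ?_
    have : f (mk [letterInv t]) * f (mk [r]) = mk (q ++ b) := by
      rw [mk_letterInv, map_inv, ← mk_imageWord f t, ← mk_imageWord f r, hpq, ← hb]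
      simp only [mk_append, mk_invRev]
      group
    rw [this]
    refine lighter_mk ?_ ?_
    · rw [hWr, List.length_append, List.length_append, hl]
    · rw [hWr, halvesCode, halvesCode, List.length_append, List.length_append, ← hl]
      have hk : p.length ≤ (p.length + b.length) / 2 := by omega
      have hk' : (p.length + b.length) / 2 ≤ b.length := by omega
      generalize (p.length + b.length) / 2 = k at hk hk'
      obtain ⟨j, rfl⟩ := Nat.exists_eq_add_of_le hk
      have h1 : (q ++ b).take (p.length + j) = q ++ b.take j := by
        rw [hl, List.take_length_add_append]
      rw [invRev_append, invRev_append, List.take_length_add_append, h1,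
        List.take_append_of_le_length (by rwa [invRev_length]),
        List.take_append_of_le_length (by rwa [invRev_length])]
      have := wordCode_append_lt hlt (b.take j)
      omega

/-- If no elementary automorphism reduces the complexity, then the images of the letters are
Nielsen reduced. -/
theorem nielsenReduced_of_not_hasReduction (hf : ConjugatesBasis V f) (h : ¬ HasReduction V f) :
    NielsenReduced f := by
  intro t r d p q hrt hdt hpt hpr hqt hqd
  by_contra! hle
  have hp : 2 * p.length ≤ (imageWord f t).length := by
    by_contra! hlt
    exact h (hasReduction_of_long_prefix hf hrt hpt hpr hlt)
  have hlt : (imageWord f (letterInv t)).length = (imageWord f t).length := by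
    rw [imageWord_letterInv, invRev_length]
  have hq : 2 * q.length ≤ (imageWord f t).length := by
    by_contra! hlt'
    exact h (hasReduction_of_long_prefix hf hdt hqt hqd (hlt.trans_lt hlt'))
  have hl : p.length = q.length := by omega
  -- The image of `t` is a product of two halves of the same length.
  have hpq : imageWord f t = p ++ invRev q := by
    obtain ⟨a, ha⟩ := hpt
    rw [imageWord_letterInv] at hqt
    obtain ⟨b, hb⟩ := hqt
    have hb' : b.length = q.length := by
      have := congrArg List.length hb
      rw [List.length_append, invRev_length] at this
      omega
    have h1 : p ++ a = invRev b ++ invRev q := by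
      rw [ha, ← invRev_append, hb, invRev_invRev]
    rw [← ha, (List.append_inj h1 (by rw [invRev_length]; omega)).2]
  have hpq' : imageWord f (letterInv t) = q ++ invRev p := by
    rw [imageWord_letterInv, hpq, invRev_append, invRev_invRev]
  have hne : p ≠ q := by
    rintro rfl
    refine mk_singleton_ne_one t (f.injective ?_)
    rw [map_one, ← mk_imageWord, hpq, mk_append, mk_invRev, mul_inv_cancel]
  have hr : r.1 ≠ t.1 := by
    intro h1
    obtain rfl := (eq_or_eq_letterInv h1).resolve_left hrt
    exact hne ((List.prefix_of_prefix_length_le hpr ⟨_, hpq'.symm⟩ hl.le).eq_of_length hl)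
  have hd : d.1 ≠ t.1 := by
    intro h1
    obtain rfl := (eq_or_eq_letterInv h1).resolve_right hdt
    exact hne ((List.prefix_of_prefix_length_le ⟨_, hpq.symm⟩ hqd hl.le).eq_of_length hl)
  rcases lt_trichotomy (wordCode p) (wordCode q) with hc | hc | hc
  · exact h (hasReduction_of_half (t := letterInv t) hf hd hpq' hl.symm hqd hc)
  · exact hne (wordCode_inj hl hc)
  · exact h (hasReduction_of_half hf hr hpq hl hpr hc)

/-- An automorphism of a free group that maps the basis elements in `V` to conjugates of
themselves is, up to an automorphism that permutes the letters, a product of elementary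
automorphisms. -/
theorem exists_mem_closure_elementaryAut (hf : ConjugatesBasis V f) :
    ∃ e : MulAut (FreeGroup α), ∃ g ∈ Subgroup.closure (elementaryAut V), f = e * g ∧
      ConjugatesBasis V e ∧ ∀ t, ∃ r, e⁻¹ (mk [t]) = mk [r] := by
  induction hc : complexity f using WellFoundedLT.induction generalizing f with
  | ind c ih =>
    by_cases h : HasReduction V f
    · obtain ⟨m, hm, hlt⟩ := h
      obtain ⟨e, g, hg, hfe, he, hel⟩ :=
        ih _ (hc ▸ hlt) (hf.mul (conjugatesBasis_of_mem_elementaryAut hm)) rfl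
      refine ⟨e, g * m⁻¹, mul_mem hg (inv_mem (Subgroup.subset_closure hm)), ?_, he, hel⟩
      rw [← mul_assoc, ← hfe, mul_inv_cancel_right]
    · exact ⟨f, 1, one_mem _, (mul_one f).symm, hf,
        (nielsenReduced_of_not_hasReduction hf h).exists_inv_apply_eq⟩

end Reduction

/-! ### Generators of the kernel of the Birman exact sequence -/

section Conjugation

variable {α : Type*} [DecidableEq α]

/-- Conjugating an automorphism `g` that fixes `s` by a transvection of `s`. -/
theorem transvection_conj {s : α} {g : MulAut (FreeGroup α)} (hgs : g (of s) = of s)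
    (hg : ∀ t, t ≠ s → g (of t) ∈ avoiding s) {u v : FreeGroup α} (hu : u ∈ avoiding s)
    (hv : v ∈ avoiding s) (hgu : g u ∈ avoiding s) (hgv : g v ∈ avoiding s) :
    transvection s u v * g * (transvection s u v)⁻¹ =
      transvection s ((g u)⁻¹ * u) (v * (g v)⁻¹) * g := by
  have h := mul_transvection hgs hg (inv_mem hu) (inv_mem hv)
  rw [transvection_inv hu hv, mul_assoc, h, ← mul_assoc, map_inv, map_inv,
    transvection_mul hu hv (inv_mem hgu) (inv_mem hgv)]

theorem transvection_conj_self {s : α} {u v u' v' : FreeGroup α} (hu : u ∈ avoiding s)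
    (hv : v ∈ avoiding s) (hu' : u' ∈ avoiding s) (hv' : v' ∈ avoiding s) :
    transvection s u v * transvection s u' v' * (transvection s u v)⁻¹ =
      transvection s (u⁻¹ * u' * u) (v * v' * v⁻¹) := by
  rw [transvection_inv hu hv, transvection_mul hu hv hu' hv',
    transvection_mul (mul_mem hu' hu) (mul_mem hv hv') (inv_mem hu) (inv_mem hv)]
  simp only [mul_assoc]

theorem conj_mem_of_forall_mem_closure {G : Type*} [Group G] {S : Set G} {a : G}
    (h : ∀ g ∈ S, a * g * a⁻¹ ∈ Subgroup.closure S) {p : G} (hp : p ∈ Subgroup.closure S) :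
    a * p * a⁻¹ ∈ Subgroup.closure S := by
  have : Subgroup.closure S ≤ (Subgroup.closure S).comap (MulAut.conj a).toMonoidHom :=
    (Subgroup.closure_le _).mpr h
  exact this hp

end Conjugation

section Generators

variable {n k : ℕ}

/-- The generator `x_i`. -/
def x (i : Fin n) : F n k := of (Sum.inl i)

theorem x_mem_avoiding_inl {i l : Fin n} (h : l ≠ i) :
    (x l : F n k) ∈ avoiding (Sum.inl i) :=
  of_mem_avoiding fun h' => h (Sum.inl_injective h')

theorem x_mem_avoiding_inr (i : Fin n) (j : Fin k) : (x i : F n k) ∈ avoiding (Sum.inr j) :=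
  of_mem_avoiding Sum.inl_ne_inr

theorem y_mem_avoiding_inl (i : Fin n) (j : Fin k) : (y j : F n k) ∈ avoiding (Sum.inl i) :=
  of_mem_avoiding Sum.inr_ne_inl

theorem y_mem_avoiding_inr {j l : Fin k} (h : l ≠ j) :
    (y l : F n k) ∈ avoiding (Sum.inr j) :=
  of_mem_avoiding fun h' => h (Sum.inr_injective h')

variable (n k) in
/-- The generators of `𝒦_{n,k}`: multiplication of an `x_i` by a `y_j` on the left or on the
right, and conjugation of a `y_j` by another basis element. -/
def birmanGenerators : Set (MulAut (F n k)) :=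
  {g | (∃ i j, g = transvection (Sum.inl i) (y j) 1) ∨
    (∃ i j, g = transvection (Sum.inl i) 1 (y j)) ∨
    ∃ j s, s ≠ Sum.inr j ∧ g = transvection (Sum.inr j) (of s) (of s)⁻¹}

/-- The partial conjugation of `y_j` by any word in the other basis elements is a product of
the given generators. -/
theorem transvection_inr_mem_closure (j : Fin k) {w : F n k} (hw : w ∈ avoiding (Sum.inr j)) :
    transvection (Sum.inr j) w w⁻¹ ∈ Subgroup.closure (birmanGenerators n k) := by
  induction hw using Subgroup.closure_induction with
  | mem w hw =>
    obtain ⟨t, ht, rfl⟩ := hw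
    exact Subgroup.subset_closure (Or.inr (Or.inr ⟨j, t, ht, rfl⟩))
  | one => rw [inv_one, transvection_one]; exact one_mem _
  | mul a b ha hb iha ihb =>
    have := mul_mem ihb iha
    rwa [transvection_mul hb (inv_mem hb) ha (inv_mem ha), ← mul_inv_rev] at this
  | inv a ha iha =>
    have := inv_mem iha
    rwa [transvection_inv ha (inv_mem ha)] at this

theorem transvection_inl_left_mem_closure (i : Fin n) (j : Fin k) {w : F n k}
    (hw : w ∈ avoiding (Sum.inr j)) (hw' : w ∈ avoiding (Sum.inl i)) :
    transvection (Sum.inl i) (w⁻¹ * y j * w) 1 ∈ Subgroup.closure (birmanGenerators n k) := by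
  have h := transvection_mul_transvection (r := Sum.inr j) (s := Sum.inl i) Sum.inr_ne_inl
    (inv_mem hw') hw' (y_mem_avoiding_inl i j) (one_mem _)
  have hc := transvection_inr_mem_closure j (inv_mem hw)
  rw [y, transvection_of_self (inv_mem hw) hw, map_one,
    ← mul_inv_eq_iff_eq_mul] at h
  rw [inv_inv] at hc
  change _ = transvection (Sum.inl i) (w⁻¹ * y j * w) 1 at h
  rw [← h]
  exact mul_mem (mul_mem hc (Subgroup.subset_closure (Or.inl ⟨i, j, rfl⟩))) (inv_mem hc)

theorem transvection_inl_right_mem_closure (i : Fin n) (j : Fin k) {w : F n k}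
    (hw : w ∈ avoiding (Sum.inr j)) (hw' : w ∈ avoiding (Sum.inl i)) :
    transvection (Sum.inl i) 1 (w⁻¹ * y j * w) ∈ Subgroup.closure (birmanGenerators n k) := by
  have h := transvection_mul_transvection (r := Sum.inr j) (s := Sum.inl i) Sum.inr_ne_inl
    (inv_mem hw') hw' (one_mem _) (y_mem_avoiding_inl i j)
  have hc := transvection_inr_mem_closure j (inv_mem hw)
  rw [y, transvection_of_self (inv_mem hw) hw, map_one,
    ← mul_inv_eq_iff_eq_mul] at h
  rw [inv_inv] at hc
  change _ = transvection (Sum.inl i) 1 (w⁻¹ * y j * w) at h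
  rw [← h]
  exact mul_mem (mul_mem hc (Subgroup.subset_closure (Or.inr (Or.inl ⟨i, j, rfl⟩)))) (inv_mem hc)

/-- The Nielsen automorphisms of the `x_i` normalize the subgroup generated by the given
generators. Each of `u` and `v` is trivial or a letter `x_l` or `x_l⁻¹`, which covers left
and right multiplication. -/
theorem nielsen_conj_mem_closure {i l : Fin n} (hil : l ≠ i) {u v : F n k}
    (hu : u = 1 ∨ u = x l ∨ u = (x l)⁻¹) (hv : v = 1 ∨ v = x l ∨ v = (x l)⁻¹)
    {g : MulAut (F n k)} (hg : g ∈ Subgroup.closure (birmanGenerators n k)) :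
    transvection (Sum.inl i) u v * g * (transvection (Sum.inl i) u v)⁻¹ ∈
      Subgroup.closure (birmanGenerators n k) := by
  have mem : ∀ s, Sum.inl l ≠ s → ∀ w : F n k, w = 1 ∨ w = x l ∨ w = (x l)⁻¹ →
      w ∈ avoiding s := by
    rintro s hs w (rfl | rfl | rfl)
    · exact one_mem _
    · exact of_mem_avoiding hs
    · exact inv_mem (of_mem_avoiding hs)
  have hli : (Sum.inl l : Fin n ⊕ Fin k) ≠ Sum.inl i := fun h => hil (Sum.inl_injective h)
  have hui := mem (Sum.inl i) hli u hu
  have hvi := mem (Sum.inl i) hli v hv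
  have hur := fun j => mem (Sum.inr j) Sum.inl_ne_inr u hu
  have hvr := fun j => mem (Sum.inr j) Sum.inl_ne_inr v hv
  refine conj_mem_of_forall_mem_closure (fun g hg => ?_) hg
  -- A generator that fixes `x_i` and `x_l` and preserves the subgroup generated by the basis
  -- elements other than `x_i` commutes with the Nielsen automorphism.
  have fixed : ∀ g : MulAut (F n k), g ∈ birmanGenerators n k → g (x i) = x i →
      (∀ t, t ≠ Sum.inl i → g (of t) ∈ avoiding (Sum.inl i)) → g (x l) = x l →
      transvection (Sum.inl i) u v * g * (transvection (Sum.inl i) u v)⁻¹ ∈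
      Subgroup.closure (birmanGenerators n k) := by
    intro g hg hgi hga hgl
    have hw : ∀ w : F n k, w = 1 ∨ w = x l ∨ w = (x l)⁻¹ → g w = w := by
      rintro w (rfl | rfl | rfl)
      · exact map_one g
      · exact hgl
      · rw [map_inv, hgl]
    rw [transvection_conj hgi hga hui hvi (by rwa [hw u hu]) (by rwa [hw v hv]), hw u hu, hw v hv,
      inv_mul_cancel, mul_inv_cancel, transvection_one, one_mul]
    exact Subgroup.subset_closure hg
  have key : ∀ (i' : Fin n) (j : Fin k) (a b : F n k), i' ≠ i →
      (a = y j ∧ b = 1 ∨ a = 1 ∧ b = y j) →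
      transvection (Sum.inl i') a b ∈ birmanGenerators n k →
      transvection (Sum.inl i) u v * transvection (Sum.inl i') a b *
        (transvection (Sum.inl i) u v)⁻¹ ∈ Subgroup.closure (birmanGenerators n k) := by
    intro i' j a b hi' hab hg
    have hab' : ∀ i', a ∈ avoiding (Sum.inl i') ∧ b ∈ avoiding (Sum.inl i') := by
      intro i'
      rcases hab with ⟨rfl, rfl⟩ | ⟨rfl, rfl⟩
      · exact ⟨y_mem_avoiding_inl i' j, one_mem _⟩
      · exact ⟨one_mem _, y_mem_avoiding_inl i' j⟩
    have hfix : transvection (Sum.inl i') a b (x i) = x i :=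
      transvection_of_mem _ _ (x_mem_avoiding_inl hi'.symm)
    have hav : ∀ t, t ≠ Sum.inl i → transvection (Sum.inl i') a b (of t) ∈
        avoiding (Sum.inl i) := by
      intro t ht
      by_cases h : t = Sum.inl i'
      · subst h
        rw [transvection_of_self (hab' i').1 (hab' i').2]
        exact mul_mem (mul_mem (hab' i).1 (of_mem_avoiding ht)) (hab' i).2
      · rw [transvection_of_ne _ _ h]
        exact of_mem_avoiding ht
    by_cases hl : i' = l
    · subst hl
      have hgl : transvection (Sum.inl i') a b (x i') = a * x i' * b :=
        transvection_of_self (hab' i').1 (hab' i').2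
      have hgm : a * x i' * b ∈ avoiding (Sum.inl i) :=
        mul_mem (mul_mem (hab' i).1 (x_mem_avoiding_inl hil)) (hab' i).2
      have hmem : ∀ w : F n k, w = 1 ∨ w = x i' ∨ w = (x i')⁻¹ →
          transvection (Sum.inl i') a b w ∈ avoiding (Sum.inl i) := by
        rintro w (rfl | rfl | rfl)
        · rw [map_one]; exact one_mem _
        · rwa [hgl]
        · rw [map_inv, hgl]; exact inv_mem hgm
      rw [transvection_conj hfix hav hui hvi (hmem u hu) (hmem v hv)]
      refine mul_mem ?_ (Subgroup.subset_closure hg)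
      -- The two multipliers are trivial or conjugates of `y_j` or its inverse by `1` or `x_l`.
      have hcase : ∀ c : F n k, (c = 1 ∨ c = y j ∨ c = (x i')⁻¹ * y j * x i' ∨
          c = x i' * y j * (x i')⁻¹) →
          c ∈ avoiding (Sum.inl i) ∧
          transvection (Sum.inl i) c 1 ∈ Subgroup.closure (birmanGenerators n k) ∧
          transvection (Sum.inl i) 1 c ∈ Subgroup.closure (birmanGenerators n k) := by
        have hy := y_mem_avoiding_inl (n := n) i j
        have hx := x_mem_avoiding_inl (k := k) hil
        have hxj := x_mem_avoiding_inr i' j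
        rintro c (rfl | rfl | rfl | rfl)
        · rw [transvection_one]
          exact ⟨one_mem _, one_mem _, one_mem _⟩
        · have h1 := transvection_inl_left_mem_closure i j (one_mem _) (one_mem _)
          have h2 := transvection_inl_right_mem_closure i j (one_mem _) (one_mem _)
          rw [inv_one, one_mul, mul_one] at h1 h2
          exact ⟨hy, h1, h2⟩
        · exact ⟨mul_mem (mul_mem (inv_mem hx) hy) hx,
            transvection_inl_left_mem_closure i j hxj hx,
            transvection_inl_right_mem_closure i j hxj hx⟩
        · have h1 := transvection_inl_left_mem_closure i j (inv_mem hxj) (inv_mem hx)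
          have h2 := transvection_inl_right_mem_closure i j (inv_mem hxj) (inv_mem hx)
          rw [inv_inv] at h1 h2
          exact ⟨mul_mem (mul_mem hx hy) (inv_mem hx), h1, h2⟩
      have hcase' : ∀ c : F n k, (c = 1 ∨ c = y j ∨ c = (x i')⁻¹ * y j * x i' ∨
          c = x i' * y j * (x i')⁻¹) ∨ (c⁻¹ = 1 ∨ c⁻¹ = y j ∨ c⁻¹ = (x i')⁻¹ * y j * x i' ∨
          c⁻¹ = x i' * y j * (x i')⁻¹) →
          c ∈ avoiding (Sum.inl i) ∧
          transvection (Sum.inl i) c 1 ∈ Subgroup.closure (birmanGenerators n k) ∧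
          transvection (Sum.inl i) 1 c ∈ Subgroup.closure (birmanGenerators n k) := by
        rintro c (h | h)
        · exact hcase c h
        · obtain ⟨h1, h2, h3⟩ := hcase _ h
          have h2' := inv_mem h2
          have h3' := inv_mem h3
          rw [transvection_inv h1 (one_mem _), inv_inv, inv_one] at h2'
          rw [transvection_inv (one_mem _) h1, inv_inv, inv_one] at h3'
          exact ⟨inv_mem_iff.mp h1, h2', h3'⟩
      obtain ⟨h1, h2, -⟩ := hcase' ((transvection (Sum.inl i') a b u)⁻¹ * u) (by
        rcases hab with ⟨rfl, rfl⟩ | ⟨rfl, rfl⟩ <;> rcases hu with rfl | rfl | rfl <;>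
          simp only [map_one, map_inv, hgl] <;> simp [mul_assoc])
      obtain ⟨h3, -, h4⟩ := hcase' (v * (transvection (Sum.inl i') a b v)⁻¹) (by
        rcases hab with ⟨rfl, rfl⟩ | ⟨rfl, rfl⟩ <;> rcases hv with rfl | rfl | rfl <;>
          simp only [map_one, map_inv, hgl] <;> simp [mul_assoc])
      have := mul_mem h2 h4
      rwa [transvection_mul h1 (one_mem _) (one_mem _) h3, one_mul, one_mul] at this
    · exact fixed _ hg hfix hav (transvection_of_mem _ _ (x_mem_avoiding_inl (Ne.symm hl)))
  have hg' := hg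
  rcases hg with ⟨i', j, rfl⟩ | ⟨i', j, rfl⟩ | ⟨j, s, hs, rfl⟩
  · by_cases hi : i' = i
    · subst hi
      rw [transvection_conj_self hui hvi (y_mem_avoiding_inl i' j) (one_mem _), mul_one,
        mul_inv_cancel]
      exact transvection_inl_left_mem_closure i' j (hur j) hui
    · exact key i' j _ _ hi (Or.inl ⟨rfl, rfl⟩) hg'
  · by_cases hi : i' = i
    · subst hi
      rw [transvection_conj_self hui hvi (one_mem _) (y_mem_avoiding_inl i' j), mul_one,
        inv_mul_cancel]
      have := transvection_inl_right_mem_closure i' j (inv_mem (hvr j)) (inv_mem hvi)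
      rwa [inv_inv] at this
    · exact key i' j _ _ hi (Or.inr ⟨rfl, rfl⟩) hg'
  · have hsm : (of s : F n k) ∈ avoiding (Sum.inr j) := of_mem_avoiding hs
    by_cases hsi : s = Sum.inl i
    · subst hsi
      rw [transvection_mul_transvection Sum.inl_ne_inr (hur j) (hvr j) hsm (inv_mem hsm),
        mul_inv_cancel_right, map_inv, transvection_of_self hui hvi]
      exact transvection_inr_mem_closure j (mul_mem (mul_mem (hur j) hsm) (hvr j))
    · refine fixed _ hg' (transvection_of_mem _ _ (x_mem_avoiding_inr i j)) (fun t ht => ?_)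
        (transvection_of_mem _ _ (x_mem_avoiding_inr l j))
      by_cases h : t = Sum.inr j
      · subst h
        rw [transvection_of_self hsm (inv_mem hsm)]
        exact mul_mem (mul_mem (of_mem_avoiding hsi) (of_mem_avoiding ht))
          (inv_mem (of_mem_avoiding hsi))
      · rw [transvection_of_ne _ _ h]
        exact of_mem_avoiding ht

end Generators

section KernelGenerators

variable {n k : ℕ}

theorem mem_autB_iff {f : MulAut (F n k)} :
    f ∈ autB n k ↔ ConjugatesBasis (Set.range Sum.inr) f := by
  constructor
  · rintro hf _ ⟨j, rfl⟩
    obtain ⟨c, hc⟩ := isConj_iff.mp (ConjClasses.mk_eq_mk_iff_isConj.mp (hf j).symm)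
    exact ⟨c, hc.symm⟩
  · intro hf j
    obtain ⟨c, hc⟩ := hf _ ⟨j, rfl⟩
    exact (ConjClasses.mk_eq_mk_iff_isConj.mpr (isConj_iff.mpr ⟨c, hc.symm⟩)).symm

theorem mem_K_iff {f : MulAut (F n k)} :
    f ∈ K n k ↔ f ∈ autB n k ∧ ∀ z, killY n k (f z) = killY n k z := by
  constructor
  · rintro ⟨g, hg, rfl⟩
    refine ⟨g.2, fun z => ?_⟩
    have := birmanProj_killY n k g z
    rw [MonoidHom.mem_ker.mp hg] at this
    exact this.symm
  · rintro ⟨hf, h⟩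
    refine ⟨⟨f, hf⟩, MonoidHom.mem_ker.mpr (MulEquiv.ext fun w => ?_), rfl⟩
    rw [← killY_inclX n k w, birmanProj_killY]
    exact h _

theorem killY_x (i : Fin n) : killY n k (x i) = of i := by
  simp [killY, x]

theorem killY_y (j : Fin k) : killY n k (y j) = 1 := by
  simp [killY, y]

theorem killY_apply_eq {f : MulAut (F n k)} (hx : ∀ i, killY n k (f (x i)) = of i)
    (hy : ∀ j, killY n k (f (y j)) = 1) (z : F n k) : killY n k (f z) = killY n k z := by
  have : (killY n k).comp f.toMonoidHom = killY n k := by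
    ext1 s
    rcases s with i | j
    · exact (hx i).trans (killY_x i).symm
    · exact (hy j).trans (killY_y j).symm
  exact DFunLike.congr_fun this z

theorem transvection_inl_mem_K {i : Fin n} {u v : F n k} (hu : u ∈ avoiding (Sum.inl i))
    (hv : v ∈ avoiding (Sum.inl i)) (hu' : killY n k u = 1) (hv' : killY n k v = 1) :
    transvection (Sum.inl i) u v ∈ K n k := by
  refine mem_K_iff.mpr ⟨mem_autB_iff.mpr ?_, killY_apply_eq (fun l => ?_) fun j => ?_⟩
  · rintro _ ⟨j, rfl⟩
    exact ⟨1, by rw [transvection_of_ne _ _ Sum.inr_ne_inl, one_mul, inv_one, mul_one]⟩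
  · rcases eq_or_ne l i with rfl | h
    · rw [x, transvection_of_self hu hv, map_mul, map_mul, hu', hv', one_mul, mul_one]
      exact killY_x l
    · rw [transvection_of_mem _ _ (x_mem_avoiding_inl h), killY_x]
  · rw [transvection_of_mem _ _ (y_mem_avoiding_inl i j), killY_y]

theorem transvection_inr_mem_K {j : Fin k} {w : F n k} (hw : w ∈ avoiding (Sum.inr j)) :
    transvection (Sum.inr j) w w⁻¹ ∈ K n k := by
  have hj : transvection (Sum.inr j) w w⁻¹ (y j) = w * y j * w⁻¹ :=
    transvection_of_self hw (inv_mem hw)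
  have hl : ∀ l, l ≠ j → transvection (Sum.inr j) w w⁻¹ (y l) = y l := fun l h =>
    transvection_of_mem _ _ (y_mem_avoiding_inr h)
  refine mem_K_iff.mpr ⟨mem_autB_iff.mpr ?_, killY_apply_eq (fun i => ?_) fun l => ?_⟩
  · rintro _ ⟨l, rfl⟩
    rcases eq_or_ne l j with rfl | h
    · exact ⟨w, hj⟩
    · exact ⟨1, by rw [one_mul, inv_one, mul_one]; exact hl l h⟩
  · rw [transvection_of_mem _ _ (x_mem_avoiding_inr i j), killY_x]
  · rcases eq_or_ne l j with rfl | h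
    · rw [hj, map_mul, map_mul, map_inv, killY_y, mul_one, mul_inv_cancel]
    · rw [hl l h, killY_y]

theorem closure_birmanGenerators_le : Subgroup.closure (birmanGenerators n k) ≤ K n k := by
  rw [Subgroup.closure_le]
  rintro _ (⟨i, j, rfl⟩ | ⟨i, j, rfl⟩ | ⟨j, s, hs, rfl⟩)
  · exact transvection_inl_mem_K (y_mem_avoiding_inl i j) (one_mem _) (killY_y j) (map_one _)
  · exact transvection_inl_mem_K (one_mem _) (y_mem_avoiding_inl i j) (map_one _) (killY_y j)
  · exact transvection_inr_mem_K (of_mem_avoiding hs)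

variable (n k) in
/-- The automorphisms that fix each `y_j` and map the subgroup generated by the `x_i` into
itself. -/
def fixingY : Submonoid (MulAut (F n k)) where
  carrier := {a | (∀ j, a (y j) = y j) ∧ ∀ w, ∃ w', a (inclX n k w) = inclX n k w'}
  one_mem' := ⟨fun _ => rfl, fun w => ⟨w, rfl⟩⟩
  mul_mem' {a b} ha hb := by
    refine ⟨fun j => ?_, fun w => ?_⟩
    · rw [MulAut.mul_apply, hb.1, ha.1]
    · obtain ⟨w', hw'⟩ := hb.2 w
      rw [MulAut.mul_apply, hw']
      exact ha.2 w'

theorem inclX_of (i : Fin n) : inclX n k (of i) = x i := by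
  simp [inclX, x]

theorem mem_fixingY {a : MulAut (F n k)} (hy : ∀ j, a (y j) = y j)
    (hx : ∀ i, ∃ w', a (x i) = inclX n k w') : a ∈ fixingY n k := by
  choose w hw using hx
  refine ⟨hy, fun z => ⟨lift w z, ?_⟩⟩
  have : a.toMonoidHom.comp (inclX n k) = (inclX n k).comp (lift w) := by
    ext1 i
    simp only [MonoidHom.comp_apply, lift_apply_of, inclX_of, ← hw]
    rfl
  exact DFunLike.congr_fun this z

theorem eq_one_of_mem_fixingY {a : MulAut (F n k)} (ha : a ∈ fixingY n k) (hK : a ∈ K n k) :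
    a = 1 := by
  refine mulAut_ext fun s => ?_
  rcases s with i | j
  · obtain ⟨w, hw⟩ := ha.2 (of i)
    have h := (mem_K_iff.mp hK).2 (inclX n k (of i))
    rw [hw, killY_inclX, killY_inclX] at h
    rw [inclX_of] at hw
    change a (x i) = x i
    rw [hw, h, inclX_of]
  · exact ha.1 j

/-- An elementary automorphism either is a product of the given generators, or is a Nielsen
automorphism of the `x_i`, which normalizes the subgroup generated by these. -/
theorem mem_closure_or_normalizes {m : MulAut (F n k)}
    (hm : m ∈ elementaryAut (Set.range (Sum.inr : Fin k → Fin n ⊕ Fin k))) :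
    m ∈ Subgroup.closure (birmanGenerators n k) ∨ m ∈ fixingY n k ∧
      ∀ g ∈ Subgroup.closure (birmanGenerators n k),
        m * g * m⁻¹ ∈ Subgroup.closure (birmanGenerators n k) := by
  obtain ⟨s, r, hr, ⟨hs, hm⟩ | ⟨⟨j, rfl⟩, rfl⟩⟩ := hm
  swap
  · exact Or.inl (transvection_inr_mem_closure j (mk_mem_avoiding hr))
  rcases s with i | j
  swap
  · exact absurd ⟨j, rfl⟩ hs
  obtain ⟨l | j, b⟩ := r
  · right
    have hli : l ≠ i := fun h => hr (congrArg Sum.inl h)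
    have hmk : (mk [(Sum.inl l, b)] : F n k) = x l ∨ mk [(Sum.inl l, b)] = (x l)⁻¹ :=
      mk_singleton_eq (Sum.inl l, b)
    obtain ⟨u, v, rfl, hu, hv⟩ : ∃ u v : F n k, m = transvection (Sum.inl i) u v ∧
        (u = 1 ∨ u = x l ∨ u = (x l)⁻¹) ∧ (v = 1 ∨ v = x l ∨ v = (x l)⁻¹) := by
      rcases hm with rfl | rfl
      · exact ⟨_, _, rfl, Or.inr hmk, Or.inl rfl⟩
      · exact ⟨_, _, rfl, Or.inl rfl, Or.inr hmk⟩
    refine ⟨mem_fixingY (fun j => transvection_of_mem _ _ (y_mem_avoiding_inl i j)) fun i' => ?_,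
      fun g hg => nielsen_conj_mem_closure hli hu hv hg⟩
    rcases eq_or_ne i' i with rfl | h
    · have hcase : ∀ w : F n k, w = 1 ∨ w = x l ∨ w = (x l)⁻¹ →
          w ∈ avoiding (Sum.inl i') ∧ ∃ w', w = inclX n k w' := by
        have hx := x_mem_avoiding_inl (k := k) hli
        rintro w (rfl | rfl | rfl)
        · exact ⟨one_mem _, 1, (map_one _).symm⟩
        · exact ⟨hx, of l, (inclX_of l).symm⟩
        · exact ⟨inv_mem hx, (of l)⁻¹, by rw [map_inv, inclX_of]⟩
      obtain ⟨hu', a, ha⟩ := hcase u hu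
      obtain ⟨hv', b, hb⟩ := hcase v hv
      refine ⟨a * of i' * b, ?_⟩
      rw [map_mul, map_mul, inclX_of, ← ha, ← hb]
      exact transvection_of_self hu' hv'
    · exact ⟨of i', by rw [inclX_of]; exact transvection_of_mem _ _ (x_mem_avoiding_inl h)⟩
  · left
    have hy := y_mem_avoiding_inl i j
    have h1 : transvection (Sum.inl i) (y j) 1 ∈ Subgroup.closure (birmanGenerators n k) :=
      Subgroup.subset_closure (Or.inl ⟨i, j, rfl⟩)
    have h2 : transvection (Sum.inl i) 1 (y j) ∈ Subgroup.closure (birmanGenerators n k) :=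
      Subgroup.subset_closure (Or.inr (Or.inl ⟨i, j, rfl⟩))
    have h1' := inv_mem h1
    have h2' := inv_mem h2
    rw [transvection_inv hy (one_mem _), inv_one] at h1'
    rw [transvection_inv (one_mem _) hy, inv_one] at h2'
    cases b
    · rcases hm with rfl | rfl
      · exact h1'
      · exact h2'
    · rcases hm with rfl | rfl
      · exact h1
      · exact h2

theorem exists_mul_of_mem_closure {g : MulAut (F n k)}
    (hg : g ∈ Subgroup.closure
      (elementaryAut (Set.range (Sum.inr : Fin k → Fin n ⊕ Fin k)))) :
    ∃ p ∈ Subgroup.closure (birmanGenerators n k), ∃ a ∈ fixingY n k, g = p * a := by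
  have step : ∀ m ∈ elementaryAut (Set.range (Sum.inr : Fin k → Fin n ⊕ Fin k)),
      ∀ g : MulAut (F n k),
      (∃ p ∈ Subgroup.closure (birmanGenerators n k), ∃ a ∈ fixingY n k, g = p * a) →
      ∃ p ∈ Subgroup.closure (birmanGenerators n k), ∃ a ∈ fixingY n k, m * g = p * a := by
    rintro m hm _ ⟨p, hp, a, ha, rfl⟩
    rcases mem_closure_or_normalizes hm with h | ⟨h, h'⟩
    · exact ⟨m * p, mul_mem h hp, a, ha, (mul_assoc _ _ _).symm⟩
    · exact ⟨m * p * m⁻¹, h' p hp, m * a, mul_mem h ha, by group⟩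
  induction hg using Subgroup.closure_induction_left with
  | one => exact ⟨1, one_mem _, 1, one_mem _, (mul_one 1).symm⟩
  | mul_left m hm g _ ih => exact step m hm g ih
  | inv_mul_cancel m hm g _ ih => exact step m⁻¹ (inv_mem_elementaryAut hm) g ih

/-- An automorphism that permutes the letters and maps each `y_j` to a conjugate fixes each `y_j`
and permutes the `x_i` up to inversion. -/
theorem mem_fixingY_of_letters {e : MulAut (F n k)}
    (he : ConjugatesBasis (Set.range (Sum.inr : Fin k → Fin n ⊕ Fin k)) e)
    (hl : ∀ t, ∃ r, e (mk [t]) = mk [r]) : e ∈ fixingY n k := by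
  have hy : ∀ j, e (y j) = y j := by
    intro j
    obtain ⟨g, hg⟩ := he _ ⟨j, rfl⟩
    obtain ⟨r, hr⟩ := hl (Sum.inr j, true)
    have h1 : mk [r] = g * of (Sum.inr j) * g⁻¹ := hr.symm.trans hg
    have h2 := congrArg (fun w => (cls (Fin n ⊕ Fin k) w).toAdd) h1
    obtain ⟨s, b⟩ := r
    have hs : cls (Fin n ⊕ Fin k) (of s) = Multiplicative.ofAdd (Pi.single s 1) := by simp [cls]
    have hj : cls (Fin n ⊕ Fin k) (of (Sum.inr j)) =
        Multiplicative.ofAdd (Pi.single (Sum.inr j) 1) := by simp [cls]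
    have h3 := congrFun h2 (Sum.inr j)
    have hinv : mk [(s, false)] = (of s)⁻¹ := rfl
    have htrue : mk [(s, true)] = of s := rfl
    have : s = Sum.inr j ∧ b = true := by
      cases b
      · simp [hinv, hs, hj, mul_comm, Pi.single_apply] at h3
        split_ifs at h3
        simp at h3
      · simp [htrue, hs, hj, mul_comm, Pi.single_apply] at h3
        exact ⟨h3.symm, rfl⟩
    obtain ⟨rfl, rfl⟩ := this
    exact hr
  refine mem_fixingY hy fun i => ?_
  obtain ⟨⟨l | j, b⟩, hr⟩ := hl (Sum.inl i, true)
  · have hr' : e (x i) = mk [(Sum.inl l, b)] := hr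
    cases b
    · exact ⟨(of l)⁻¹, by rw [map_inv, inclX_of]; exact hr'⟩
    · exact ⟨of l, by rw [inclX_of]; exact hr'⟩
  · have hj : e (mk [(Sum.inr j, b)]) = mk [(Sum.inr j, b)] := by
      cases b
      · have : mk [((Sum.inr j : Fin n ⊕ Fin k), false)] = (y j)⁻¹ := rfl
        rw [this, map_inv, hy]
      · exact hy j
    have := mk_injective_letter (e.injective (hr.trans hj.symm))
    simp at this

/-- The kernel of the Birman exact sequence is generated by the automorphisms multiplying some
`x_i` by some `y_j` and the conjugations of the `y_j` by basis elements. -/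
theorem K_eq_closure : K n k = Subgroup.closure (birmanGenerators n k) := by
  refine le_antisymm (fun f hf => ?_) closure_birmanGenerators_le
  have hB : ConjugatesBasis _ f⁻¹ := mem_autB_iff.mp (mem_K_iff.mp (inv_mem hf)).1
  obtain ⟨e, g, hg, hfe, he, hel⟩ := exists_mem_closure_elementaryAut hB
  obtain ⟨p, hp, a, ha, hpa⟩ := exists_mul_of_mem_closure (inv_mem hg)
  have he' : e⁻¹ ∈ fixingY n k :=
    mem_fixingY_of_letters (mem_autB_iff.mp (inv_mem (mem_autB_iff.mpr he))) hel
  have hf' : f = p * (a * e⁻¹) := by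
    rw [← mul_assoc, ← hpa, ← mul_inv_rev, ← hfe, inv_inv]
  have h1 : a * e⁻¹ = 1 := by
    refine eq_one_of_mem_fixingY (mul_mem ha he') ?_
    rw [hf'] at hf
    exact (Subgroup.mul_mem_cancel_left _ (closure_birmanGenerators_le hp)).mp hf
  rwa [hf', h1, mul_one]

end KernelGenerators

/-! ### Generators of the Torelli part of the kernel modulo its commutator subgroup -/

section Quotient

open scoped commutatorElement

/-- If `G` is generated by a normal subgroup `H` and elements `a s` that commute modulo `H`, then
a homomorphism to a free abelian group that kills `H` and maps the `a s` to a basis has no kernel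
beyond `H`. -/
theorem ker_le_of_commutator_mem {G σ : Type*} [Group G] [Fintype σ] [DecidableEq σ]
    {H : Subgroup G} [H.Normal] {a : σ → G} (θ : G →* Multiplicative (σ → ℤ))
    (hgen : Subgroup.closure (H ∪ Set.range a) = ⊤) (hcomm : ∀ s t, ⁅a s, a t⁆ ∈ H)
    (hH : H ≤ θ.ker) (ha : ∀ s, θ (a s) = Multiplicative.ofAdd (Pi.single s 1)) : θ.ker ≤ H := by
  have hc : ∀ s t, (a s : G ⧸ H) * a t = a t * a s := by
    intro s t
    have h := (QuotientGroup.eq_one_iff _).mpr (hcomm s t)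
    rw [← QuotientGroup.mk'_apply, map_commutatorElement, commutatorElement_eq_one_iff_mul_comm] at h
    exact h
  have key : ∀ s, ∀ g : G, (a s : G ⧸ H) * g = g * a s := by
    intro s g
    have hg : g ∈ Subgroup.closure (H ∪ Set.range a) := hgen ▸ Subgroup.mem_top g
    induction hg using Subgroup.closure_induction with
    | mem g hg =>
      rcases hg with hg | ⟨t, rfl⟩
      · rw [(QuotientGroup.eq_one_iff g).mpr hg, one_mul, mul_one]
      · exact hc s t
    | one => rw [QuotientGroup.mk_one, one_mul, mul_one]
    | mul g h _ _ hg hh => rw [QuotientGroup.mk_mul, ← mul_assoc, hg, mul_assoc, hh, mul_assoc]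
    | inv g _ hg => exact Commute.inv_right hg
  have key' : ∀ g h : G, (g : G ⧸ H) * h = h * g := by
    intro g h
    have hg : g ∈ Subgroup.closure (H ∪ Set.range a) := hgen ▸ Subgroup.mem_top g
    induction hg using Subgroup.closure_induction with
    | mem g hg =>
      rcases hg with hg | ⟨t, rfl⟩
      · rw [(QuotientGroup.eq_one_iff g).mpr hg, one_mul, mul_one]
      · exact key t h
    | one => rw [QuotientGroup.mk_one, one_mul, mul_one]
    | mul g g' _ _ hg hg' => rw [QuotientGroup.mk_mul, mul_assoc, hg', ← mul_assoc, hg, mul_assoc]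
    | inv g _ hg => exact (Commute.inv_right (a := (h : G ⧸ H)) hg.symm).symm
  let inst : CommGroup (G ⧸ H) :=
    { (inferInstance : Group (G ⧸ H)) with
      mul_comm := fun p q => by
        induction p using QuotientGroup.induction_on
        induction q using QuotientGroup.induction_on
        exact key' _ _ }
  let χ : G →* G ⧸ H := MonoidHom.mk' (fun g => ∏ s, (a s : G ⧸ H) ^ (θ g).toAdd s) fun g h => by
    rw [← Finset.prod_mul_distrib]
    refine Finset.prod_congr rfl fun s _ => ?_
    rw [map_mul, toAdd_mul, Pi.add_apply, zpow_add]
  have hχ : χ = QuotientGroup.mk' H := by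
    refine MonoidHom.eq_of_eqOn_dense hgen ?_
    rintro g (hg | ⟨t, rfl⟩)
    · have h1 : θ g = 1 := hH hg
      have h2 : (g : G ⧸ H) = 1 := (QuotientGroup.eq_one_iff g).mpr hg
      change ∏ s, (a s : G ⧸ H) ^ (θ g).toAdd s = (g : G ⧸ H)
      rw [h1, h2]
      exact Finset.prod_eq_one fun s _ => zpow_zero _
    · change ∏ s, (a s : G ⧸ H) ^ (θ (a t)).toAdd s = (a t : G ⧸ H)
      rw [ha, Finset.prod_eq_single t]
      · rw [toAdd_ofAdd, Pi.single_eq_same, zpow_one]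
      · intro s _ hs
        rw [toAdd_ofAdd, Pi.single_eq_of_ne hs, zpow_zero]
      · exact fun h => absurd (Finset.mem_univ t) h
  intro g hg
  rw [← QuotientGroup.eq_one_iff, ← QuotientGroup.mk'_apply, ← hχ]
  change ∏ s, (a s : G ⧸ H) ^ (θ g).toAdd s = 1
  rw [MonoidHom.mem_ker.mp hg]
  exact Finset.prod_eq_one fun s _ => zpow_zero _

end Quotient

section TorelliGenerators

open scoped commutatorElement

variable (n k : ℕ)

/-- The index set of the generators of the Torelli part of the kernel. -/
abbrev GeneratorIndex : Type :=
  {p : Fin n × Fin n // p.1 ≠ p.2} × Fin k ⊕ Fin n × {p : Fin k × Fin k // p.1 < p.2} ⊕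
    Fin n × Fin k ⊕ Fin n × Fin k ⊕ {p : Fin k × Fin k // p.1 ≠ p.2}

variable {n k}

/-- The generators of the Torelli part of the kernel: left multiplication of `x_i` by `[x_l, y_j]`
or by `[y_a, y_b]`, conjugation of `x_i` by `y_j`, of `y_j` by `x_i` and of `y_a` by `y_b`. -/
def torelliGenerator : GeneratorIndex n k → MulAut (F n k)
  | .inl (p, j) => transvection (Sum.inl p.1.1) ⁅(x p.1.2 : F n k), y j⁆ 1
  | .inr (.inl (i, p)) => transvection (Sum.inl i) ⁅(y p.1.1 : F n k), y p.1.2⁆ 1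
  | .inr (.inr (.inl (i, j))) => transvection (Sum.inl i) (y j) (y j)⁻¹
  | .inr (.inr (.inr (.inl (i, j)))) => transvection (Sum.inr j) (x i) (x i)⁻¹
  | .inr (.inr (.inr (.inr p))) => transvection (Sum.inr p.1.1) (y p.1.2) (y p.1.2)⁻¹

theorem commutator_mem_avoiding {α : Type*} {s : α} {u v : FreeGroup α} (hu : u ∈ avoiding s)
    (hv : v ∈ avoiding s) : ⁅u, v⁆ ∈ avoiding s := by
  rw [commutatorElement_def]
  exact mul_mem (mul_mem (mul_mem hu hv) (inv_mem hu)) (inv_mem hv)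

theorem mem_IA_iff {α : Type*} {f : MulAut (FreeGroup α)} :
    f ∈ IA α ↔ ∀ s, Abelianization.of (f (of s)) = Abelianization.of (of s) := by
  constructor
  · intro hf s
    exact DFunLike.congr_fun (MonoidHom.mem_ker.mp hf) (Abelianization.of (of s))
  · intro h
    have h1 : Abelianization.of.comp f.toMonoidHom = Abelianization.of := by
      ext1 s
      exact h s
    refine MonoidHom.mem_ker.mpr (MulEquiv.ext fun z => ?_)
    induction z using QuotientGroup.induction_on with
    | _ z => exact DFunLike.congr_fun h1 z

theorem transvection_mem_IA {α : Type*} [DecidableEq α] {s : α} {u v : FreeGroup α}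
    (hu : u ∈ avoiding s) (hv : v ∈ avoiding s)
    (h : Abelianization.of u * Abelianization.of v = 1) : transvection s u v ∈ IA α := by
  refine mem_IA_iff.mpr fun t => ?_
  rcases eq_or_ne t s with rfl | hts
  · rw [transvection_of_self hu hv, map_mul, map_mul, mul_right_comm, h, one_mul]
  · rw [transvection_of_ne _ _ hts]

theorem torelliGenerator_mem_KIA (s : GeneratorIndex n k) : torelliGenerator s ∈ KIA n k := by
  have hconj : ∀ w : F n k, Abelianization.of w * Abelianization.of w⁻¹ = 1 := fun w => by
    rw [← map_mul, mul_inv_cancel, map_one]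
  have hcomm : ∀ v w : F n k, Abelianization.of ⁅v, w⁆ * Abelianization.of (1 : F n k) = 1 :=
    fun v w => by
      rw [map_one, mul_one, map_commutatorElement, commutatorElement_eq_one_iff_mul_comm, mul_comm]
  have hx : ∀ {i l : Fin n}, l ≠ i → (x l : F n k) ∈ avoiding (Sum.inl i) := x_mem_avoiding_inl
  have hxr := x_mem_avoiding_inr (n := n) (k := k)
  have hy := y_mem_avoiding_inl (n := n) (k := k)
  have hyr : ∀ {a b : Fin k}, b ≠ a → (y b : F n k) ∈ avoiding (Sum.inr a) := y_mem_avoiding_inr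
  rcases s with ⟨⟨⟨i, l⟩, hil⟩, j⟩ | ⟨i, ⟨⟨a, b⟩, hab⟩⟩ | ⟨i, j⟩ | ⟨i, j⟩ | ⟨⟨a, b⟩, hab⟩
  · have h := commutator_mem_avoiding (hx (Ne.symm hil)) (hy i j)
    exact ⟨transvection_inl_mem_K h (one_mem _)
      (by rw [map_commutatorElement, killY_y, commutatorElement_one_right]) (map_one _),
      transvection_mem_IA h (one_mem _) (hcomm _ _)⟩
  · have h := commutator_mem_avoiding (hy i a) (hy i b)
    exact ⟨transvection_inl_mem_K h (one_mem _)
      (by rw [map_commutatorElement, killY_y, killY_y, commutatorElement_one_right]) (map_one _),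
      transvection_mem_IA h (one_mem _) (hcomm _ _)⟩
  · exact ⟨transvection_inl_mem_K (hy i j) (inv_mem (hy i j)) (killY_y j)
      (by rw [map_inv, killY_y, inv_one]), transvection_mem_IA (hy i j) (inv_mem (hy i j)) (hconj _)⟩
  · exact ⟨transvection_inr_mem_K (hxr i j),
      transvection_mem_IA (hxr i j) (inv_mem (hxr i j)) (hconj _)⟩
  · have h := hyr (Ne.symm hab)
    exact ⟨transvection_inr_mem_K h, transvection_mem_IA h (inv_mem h) (hconj _)⟩

variable (n k) in
/-- The subgroup generated by the given generators and the commutators of the Torelli part of the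
kernel. -/
def torelliSpan : Subgroup (MulAut (F n k)) :=
  Subgroup.closure (Set.range torelliGenerator) ⊔ ⁅KIA n k, KIA n k⁆

theorem torelliGenerator_mem_span (s : GeneratorIndex n k) :
    torelliGenerator s ∈ torelliSpan n k :=
  (le_sup_left : _ ≤ torelliSpan n k) (Subgroup.subset_closure ⟨s, rfl⟩)

theorem torelliSpan_le_KIA : torelliSpan n k ≤ KIA n k := by
  refine sup_le ?_ (Subgroup.commutator_le_self _)
  rw [Subgroup.closure_le]
  rintro _ ⟨s, rfl⟩
  exact torelliGenerator_mem_KIA s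

theorem conj_mem_KIA {g h : MulAut (F n k)} (hg : g ∈ K n k) (hh : h ∈ KIA n k) :
    g * h * g⁻¹ ∈ KIA n k := by
  obtain ⟨h1, h2⟩ := Subgroup.mem_inf.mp hh
  exact Subgroup.mem_inf.mpr ⟨mul_mem (mul_mem hg h1) (inv_mem hg),
    (inferInstance : (autAb (F n k)).ker.Normal).conj_mem h h2 g⟩

/-- The words `c` for which left multiplication of `x_i` by `c` lies in `torelliSpan`. -/
def leftMultipliers (i : Fin n) : Subgroup (F n k) where
  carrier := {c | c ∈ avoiding (Sum.inl i) ∧ transvection (Sum.inl i) c 1 ∈ torelliSpan n k}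
  one_mem' := ⟨one_mem _, by rw [transvection_one]; exact one_mem _⟩
  mul_mem' {c d} hc hd := by
    refine ⟨mul_mem hc.1 hd.1, ?_⟩
    have := mul_mem hd.2 hc.2
    rwa [transvection_mul hd.1 (one_mem _) hc.1 (one_mem _), mul_one] at this
  inv_mem' {c} hc := by
    refine ⟨inv_mem hc.1, ?_⟩
    have := inv_mem hc.2
    rwa [transvection_inv hc.1 (one_mem _), inv_one] at this

/-- `z` is the basis element `y_j` or its inverse. -/
def IsLetterY (j : Fin k) (z : F n k) : Prop := z = y j ∨ z = (y j)⁻¹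

theorem IsLetterY.inv {j : Fin k} {z : F n k} (hz : IsLetterY j z) : IsLetterY j z⁻¹ := by
  rcases hz with rfl | rfl
  · exact Or.inr rfl
  · exact Or.inl (inv_inv _)

theorem IsLetterY.mem_avoiding {j : Fin k} {z : F n k} (hz : IsLetterY j z)
    {s : Fin n ⊕ Fin k} (hs : Sum.inr j ≠ s) : z ∈ avoiding s := by
  rcases hz with rfl | rfl
  · exact of_mem_avoiding hs
  · exact inv_mem (of_mem_avoiding hs)

theorem conj_x_mem_span (i : Fin n) {j : Fin k} {z : F n k} (hz : IsLetterY j z) :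
    transvection (Sum.inl i) z z⁻¹ ∈ torelliSpan n k := by
  have h := torelliGenerator_mem_span (.inr (.inr (.inl (i, j))) : GeneratorIndex n k)
  rcases hz with rfl | rfl
  · exact h
  · have hy := y_mem_avoiding_inl i j
    have h' := inv_mem h
    rwa [torelliGenerator, transvection_inv hy (inv_mem hy)] at h'

theorem conj_y_mem_span {j b : Fin k} (hbj : b ≠ j) {z : F n k} (hz : IsLetterY j z) :
    transvection (Sum.inr b) z z⁻¹ ∈ torelliSpan n k := by
  have h := torelliGenerator_mem_span
    (.inr (.inr (.inr (.inr ⟨(b, j), hbj⟩))) : GeneratorIndex n k)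
  rcases hz with rfl | rfl
  · exact h
  · have hy := y_mem_avoiding_inr (n := n) hbj.symm
    have h' := inv_mem h
    rwa [torelliGenerator, transvection_inv hy (inv_mem hy)] at h'

theorem conj_mem_leftMultipliers {i : Fin n} {j : Fin k} {z c : F n k} (hz : IsLetterY j z)
    (hc : c ∈ leftMultipliers i) : z * c * z⁻¹ ∈ leftMultipliers i := by
  have hzi := hz.mem_avoiding (s := Sum.inl i) Sum.inr_ne_inl
  refine ⟨mul_mem (mul_mem hzi hc.1) (inv_mem hzi), ?_⟩
  have h1 := conj_x_mem_span i hz.inv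
  have := mul_mem (mul_mem h1 hc.2) (inv_mem h1)
  rwa [inv_inv, transvection_conj_self (inv_mem hzi) hzi hc.1 (one_mem _), inv_inv, mul_one,
    mul_inv_cancel] at this

theorem commutator_xy_mem_leftMultipliers {i l : Fin n} (hil : i ≠ l) {j : Fin k} {z : F n k}
    (hz : IsLetterY j z) : ⁅(x l : F n k), z⁆ ∈ leftMultipliers i := by
  have h : ⁅(x l : F n k), y j⁆ ∈ leftMultipliers i :=
    ⟨commutator_mem_avoiding (x_mem_avoiding_inl hil.symm) (y_mem_avoiding_inl i j),
      torelliGenerator_mem_span (.inl (⟨(i, l), hil⟩, j))⟩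
  rcases hz with rfl | rfl
  · exact h
  · have h' := conj_mem_leftMultipliers (j := j) (z := (y j)⁻¹) (Or.inr rfl) (inv_mem h)
    have e : ⁅(x l : F n k), (y j : F n k)⁻¹⁆ = (y j)⁻¹ * ⁅(x l : F n k), (y j : F n k)⁆⁻¹ * (y j)⁻¹⁻¹ := by
      simp only [commutatorElement_def]
      group
    rwa [e]

theorem commutator_yy_mem_leftMultipliers (i : Fin n) {a b : Fin k} {z : F n k}
    (hz : IsLetterY a z) : ⁅z, y b⁆ ∈ leftMultipliers i := by
  have h0 : ∀ a b : Fin k, a < b → ⁅(y a : F n k), y b⁆ ∈ leftMultipliers i :=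
    fun a b hab => ⟨commutator_mem_avoiding (y_mem_avoiding_inl i a) (y_mem_avoiding_inl i b),
      torelliGenerator_mem_span (.inr (.inl (i, ⟨(a, b), hab⟩)))⟩
  have h : ⁅(y a : F n k), y b⁆ ∈ leftMultipliers i := by
    rcases lt_trichotomy a b with hab | rfl | hab
    · exact h0 a b hab
    · rw [commutatorElement_self]
      exact one_mem _
    · rw [← commutatorElement_inv]
      exact inv_mem (h0 b a hab)
  rcases hz with rfl | rfl
  · exact h
  · have h' := conj_mem_leftMultipliers (j := a) (z := (y a)⁻¹) (Or.inr rfl) (inv_mem h)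
    have e : ⁅(y a : F n k)⁻¹, (y b : F n k)⁆ = (y a)⁻¹ * ⁅(y a : F n k), (y b : F n k)⁆⁻¹ * (y a)⁻¹⁻¹ := by
      simp only [commutatorElement_def]
      group
    rwa [e]

/-- Conjugation by the left multiplication of `x_i` by `y_j` or its inverse maps each of the
generators into `torelliSpan`. -/
theorem conj_torelliGenerator_mem_span (i : Fin n) {j : Fin k} {z : F n k} (hz : IsLetterY j z)
    (s : GeneratorIndex n k) :
    transvection (Sum.inl i) z 1 * torelliGenerator s * (transvection (Sum.inl i) z 1)⁻¹ ∈
      torelliSpan n k := by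
  have hx : ∀ {i l : Fin n}, l ≠ i → (x l : F n k) ∈ avoiding (Sum.inl i) := x_mem_avoiding_inl
  have hxr := x_mem_avoiding_inr (n := n) (k := k)
  have hy := y_mem_avoiding_inl (n := n) (k := k)
  have hyr : ∀ {a b : Fin k}, b ≠ a → (y b : F n k) ∈ avoiding (Sum.inr a) := y_mem_avoiding_inr
  have hzl : ∀ i, z ∈ avoiding (Sum.inl i) := fun i => hz.mem_avoiding Sum.inr_ne_inl
  have hzr : ∀ b, j ≠ b → z ∈ avoiding (Sum.inr b) := fun b hb =>
    hz.mem_avoiding fun h => hb (Sum.inr_injective h)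
  -- A transvection of another basis element whose multipliers avoid `x_i` changes by a left
  -- multiplication of `x_i`, which is trivial if that element is not `y_j`.
  have other : ∀ (r : Fin n ⊕ Fin k) (u v : F n k), r ≠ Sum.inl i → u ∈ avoiding r →
      v ∈ avoiding r → u ∈ avoiding (Sum.inl i) → v ∈ avoiding (Sum.inl i) →
      transvection r u v ∈ torelliSpan n k →
      (r = Sum.inr j → (u * z * v)⁻¹ * z ∈ leftMultipliers i ∧ v = u⁻¹) →
      transvection (Sum.inl i) z 1 * transvection r u v * (transvection (Sum.inl i) z 1)⁻¹ ∈
        torelliSpan n k := by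
    intro r u v hr hu hv hui hvi hs hrj
    have hav : ∀ t, t ≠ Sum.inl i → transvection r u v (of t) ∈ avoiding (Sum.inl i) := by
      intro t ht
      rcases eq_or_ne t r with rfl | h
      · rw [transvection_of_self hu hv]
        exact mul_mem (mul_mem hui (of_mem_avoiding ht)) hvi
      · rw [transvection_of_ne _ _ h]
        exact of_mem_avoiding ht
    have hfix := transvection_of_ne u v hr.symm
    by_cases h : r = Sum.inr j
    · obtain ⟨hm, rfl⟩ := hrj h
      subst h
      have hzz : transvection (Sum.inr j) u u⁻¹ z = u * z * u⁻¹ := by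
        have : transvection (Sum.inr j) u u⁻¹ (y j) = u * y j * u⁻¹ := transvection_of_self hu hv
        rcases hz with rfl | rfl
        · exact this
        · rw [map_inv, this]
          group
      rw [transvection_conj hfix hav (hzl i) (one_mem _)
        (by rw [hzz]; exact mul_mem (mul_mem hui (hzl i)) hvi) (by rw [map_one]; exact one_mem _),
        hzz, map_one, inv_one, mul_one]
      exact mul_mem hm.2 hs
    · have hzz := transvection_of_mem u v (hz.mem_avoiding (Ne.symm h))
      rw [transvection_conj hfix hav (hzl i) (one_mem _) (by rw [hzz]; exact hzl i)
        (by rw [map_one]; exact one_mem _), hzz, map_one, inv_mul_cancel, inv_one, mul_one,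
        transvection_one, one_mul]
      exact hs
  -- A left multiplication of `x_i` changes by conjugation of its multiplier.
  have same : ∀ c : F n k, c ∈ leftMultipliers i →
      transvection (Sum.inl i) z 1 * transvection (Sum.inl i) c 1 *
        (transvection (Sum.inl i) z 1)⁻¹ ∈ torelliSpan n k := by
    intro c hc
    rw [transvection_conj_self (hzl i) (one_mem _) hc.1 (one_mem _), mul_one, one_mul, inv_one]
    have := (conj_mem_leftMultipliers hz.inv hc).2
    rwa [inv_inv] at this
  have hs := torelliGenerator_mem_span s
  rcases s with ⟨⟨⟨i', l⟩, hil⟩, b⟩ | ⟨i', ⟨⟨a, b⟩, hab⟩⟩ | ⟨i', b⟩ | ⟨i', b⟩ | ⟨⟨b, c⟩, hbc⟩ <;>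
    rw [torelliGenerator] at hs ⊢ <;> try dsimp only at hs ⊢
  · have hil' : i' ≠ l := hil
    by_cases hi : i' = i
    · subst hi
      exact same _ (commutator_xy_mem_leftMultipliers hil' (Or.inl rfl))
    have hi' : (Sum.inl i' : Fin n ⊕ Fin k) ≠ Sum.inl i := fun h => hi (Sum.inl_injective h)
    by_cases hl : l = i
    · subst hl
      have hc := commutator_mem_avoiding (hx hil'.symm) (hy i' b)
      have hzx : transvection (Sum.inl l) z 1 (x l) = z * x l * 1 :=
        transvection_of_self (hzl l) (one_mem _)
      rw [transvection_mul_transvection hi'.symm (hzl i') (one_mem _) hc (one_mem _),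
        mul_inv_cancel_right, map_one, map_commutatorElement, hzx, mul_one,
        transvection_of_mem _ _ (hy l b)]
      have e : ⁅z * x l, (y b : F n k)⁆ = z * ⁅(x l : F n k), (y b : F n k)⁆ * z⁻¹ * ⁅z, (y b : F n k)⁆ := by
        simp only [commutatorElement_def]
        group
      rw [e]
      exact (mul_mem (conj_mem_leftMultipliers hz
        (commutator_xy_mem_leftMultipliers hil' (Or.inl rfl)))
        (commutator_yy_mem_leftMultipliers i' hz)).2
    · exact other _ _ _ hi' (commutator_mem_avoiding (hx hil'.symm) (hy i' b)) (one_mem _)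
        (commutator_mem_avoiding (hx hl) (hy i b)) (one_mem _) hs
        fun h => absurd h Sum.inl_ne_inr
  · by_cases hi : i' = i
    · subst hi
      exact same _ (commutator_yy_mem_leftMultipliers i' (Or.inl rfl))
    · exact other _ _ _ (fun h => hi (Sum.inl_injective h))
        (commutator_mem_avoiding (hy i' a) (hy i' b)) (one_mem _)
        (commutator_mem_avoiding (hy i a) (hy i b)) (one_mem _) hs
        fun h => absurd h Sum.inl_ne_inr
  · by_cases hi : i' = i
    · subst hi
      have hc := commutator_yy_mem_leftMultipliers i' (b := b) hz.inv
      have := mul_mem hs hc.2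
      rw [transvection_mul (hy i' b) (inv_mem (hy i' b)) hc.1 (one_mem _)] at this
      rw [transvection_conj_self (hzl i') (one_mem _) (hy i' b) (inv_mem (hy i' b))]
      convert this using 2
      · simp only [commutatorElement_def]
        group
      · group
    · exact other _ _ _ (fun h => hi (Sum.inl_injective h)) (hy i' b) (inv_mem (hy i' b))
        (hy i b) (inv_mem (hy i b)) hs fun h => absurd h Sum.inl_ne_inr
  · by_cases hi : i' = i
    · subst hi
      have hzx : transvection (Sum.inl i') z 1 (x i') = z * x i' * 1 :=
        transvection_of_self (hzl i') (one_mem _)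
      by_cases hb : b = j
      · subst hb
        have e : transvection (Sum.inl i') z 1 * transvection (Sum.inr b) (x i') (x i')⁻¹ =
            transvection (Sum.inl i') z z⁻¹ * transvection (Sum.inr b) (x i') (x i')⁻¹ *
              transvection (Sum.inl i') z 1 := by
          have hcz : transvection (Sum.inl i') z z⁻¹ (x i') = z * x i' * z⁻¹ :=
            transvection_of_self (hzl i') (inv_mem (hzl i'))
          have hcy : transvection (Sum.inr b) (x i') (x i')⁻¹ (y b) = x i' * y b * (x i')⁻¹ :=
            transvection_of_self (hxr i' b) (inv_mem (hxr i' b))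
          have hcx := transvection_of_mem (x i') (x i')⁻¹ (hxr i' b)
          have hzy := transvection_of_mem z 1 (hy i' b)
          have hzy' := transvection_of_mem z z⁻¹ (hy i' b)
          refine mulAut_ext fun t => ?_
          simp only [MulAut.mul_apply]
          rcases eq_or_ne t (Sum.inl i') with rfl | h1
          · change transvection (Sum.inl i') z 1 (transvection (Sum.inr b) _ _ (x i')) =
              transvection (Sum.inl i') z z⁻¹ (transvection (Sum.inr b) _ _
                (transvection (Sum.inl i') z 1 (x i')))
            rw [hcx, hzx, mul_one, map_mul, hcx]
            rcases hz with rfl | rfl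
            · rw [hcy, map_mul, map_mul, map_mul, map_inv, hcz, hzy']
              group
            · rw [map_inv, hcy, map_mul, map_inv, map_mul, map_mul, map_inv, hcz, hzy']
              group
          · rcases eq_or_ne t (Sum.inr b) with rfl | h2
            · change transvection (Sum.inl i') z 1 (transvection (Sum.inr b) _ _ (y b)) =
                transvection (Sum.inl i') z z⁻¹ (transvection (Sum.inr b) _ _
                  (transvection (Sum.inl i') z 1 (y b)))
              rw [hzy, hcy, map_mul, map_mul, map_inv, hzx, hzy, map_mul, map_mul, map_inv, hcz,
                hzy']
              rcases hz with rfl | rfl <;> group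
            · rw [transvection_of_ne _ _ h2, transvection_of_ne z 1 h1, transvection_of_ne _ _ h2,
                transvection_of_ne z z⁻¹ h1]
        rw [e, mul_inv_cancel_right]
        exact mul_mem (conj_x_mem_span i' hz) hs
      · rw [transvection_mul_transvection Sum.inl_ne_inr (hzr b (Ne.symm hb)) (one_mem _)
          (hxr i' b) (inv_mem (hxr i' b)), mul_inv_cancel_right, map_inv, hzx, mul_one]
        have := mul_mem hs (conj_y_mem_span hb hz)
        rwa [transvection_mul (hxr i' b) (inv_mem (hxr i' b)) (hzr b (Ne.symm hb))
          (inv_mem (hzr b (Ne.symm hb))), ← mul_inv_rev] at this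
    · refine other _ _ _ Sum.inr_ne_inl (hxr i' b) (inv_mem (hxr i' b)) (hx hi)
        (inv_mem (hx hi)) hs fun _ => ⟨?_, rfl⟩
      have := commutator_xy_mem_leftMultipliers (Ne.symm hi) hz.inv
      convert this using 1
      simp only [commutatorElement_def]
      group
  · have hcb : (y c : F n k) ∈ avoiding (Sum.inr b) := hyr (Ne.symm hbc)
    refine other _ _ _ Sum.inr_ne_inl hcb (inv_mem hcb) (hy i c) (inv_mem (hy i c)) hs
      fun _ => ⟨?_, rfl⟩
    have := inv_mem (commutator_yy_mem_leftMultipliers (b := c) i hz.inv)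
    convert this using 1
    simp only [commutatorElement_def]
    group

end TorelliGenerators

section SpanNormal

open scoped commutatorElement

variable {n k : ℕ}

theorem conj_transvection_mem_span (i : Fin n) {j : Fin k} {z : F n k} (hz : IsLetterY j z)
    {h : MulAut (F n k)} (hh : h ∈ torelliSpan n k) :
    transvection (Sum.inl i) z 1 * h * (transvection (Sum.inl i) z 1)⁻¹ ∈ torelliSpan n k := by
  have hzi := hz.mem_avoiding (s := Sum.inl i) Sum.inr_ne_inl
  have hzK : transvection (Sum.inl i) z 1 ∈ K n k := by
    refine transvection_inl_mem_K hzi (one_mem _) ?_ (map_one _)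
    rcases hz with rfl | rfl
    · exact killY_y j
    · rw [map_inv, killY_y, inv_one]
  have : torelliSpan n k ≤
      (torelliSpan n k).comap (MulAut.conj (transvection (Sum.inl i) z 1)).toMonoidHom := by
    refine sup_le ?_ ?_
    · rw [Subgroup.closure_le]
      rintro _ ⟨s, rfl⟩
      exact conj_torelliGenerator_mem_span i hz s
    · rw [Subgroup.commutator_le]
      intro g hg g' hg'
      rw [Subgroup.mem_comap, map_commutatorElement]
      exact (le_sup_right : _ ≤ torelliSpan n k)
        (Subgroup.commutator_mem_commutator (conj_mem_KIA hzK hg) (conj_mem_KIA hzK hg'))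
  exact this hh

theorem leftMul_mem_normalizer (i : Fin n) (j : Fin k) :
    transvection (Sum.inl i) (y j) 1 ∈
      Subgroup.normalizer (torelliSpan n k : Set (MulAut (F n k))) := by
  refine Subgroup.mem_normalizer_iff.mpr fun h => ⟨conj_transvection_mem_span i (Or.inl rfl), ?_⟩
  intro hh
  have := conj_transvection_mem_span i (j := j) (Or.inr rfl) hh
  have hy := y_mem_avoiding_inl i j
  have e : transvection (Sum.inl i) (y j)⁻¹ 1 = (transvection (Sum.inl i) (y j) 1)⁻¹ := by
    rw [transvection_inv hy (one_mem _), inv_one]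
  rw [e] at this
  convert this using 1
  group

/-- The right multiplication of `x_i` by `y_j` differs from the left one by a conjugation. -/
theorem rightMul_eq (i : Fin n) (j : Fin k) :
    transvection (Sum.inl i) 1 (y j) =
      transvection (Sum.inl i) (y j) 1 * (transvection (Sum.inl i) (y j) (y j)⁻¹)⁻¹ := by
  have hy := y_mem_avoiding_inl i j
  rw [transvection_inv hy (inv_mem hy), transvection_mul hy (one_mem _) (inv_mem hy)
    (inv_mem (inv_mem hy)), inv_mul_cancel, inv_inv, one_mul]

theorem K_le_closure : K n k ≤ Subgroup.closure
    ((torelliSpan n k : Set (MulAut (F n k))) ∪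
      Set.range fun p : Fin n × Fin k => transvection (Sum.inl p.1) (y p.2) 1) := by
  rw [K_eq_closure, Subgroup.closure_le]
  have hL : ∀ (i : Fin n) (j : Fin k), transvection (Sum.inl i) (y j) 1 ∈ Subgroup.closure
      ((torelliSpan n k : Set (MulAut (F n k))) ∪
        Set.range fun p : Fin n × Fin k => transvection (Sum.inl p.1) (y p.2) 1) :=
    fun i j => Subgroup.subset_closure (Or.inr ⟨(i, j), rfl⟩)
  rintro _ (⟨i, j, rfl⟩ | ⟨i, j, rfl⟩ | ⟨j, s, hs, rfl⟩)
  · exact hL i j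
  · rw [SetLike.mem_coe, rightMul_eq]
    exact mul_mem (hL i j) (inv_mem (Subgroup.subset_closure
      (Or.inl (conj_x_mem_span i (Or.inl rfl)))))
  · refine Subgroup.subset_closure (Or.inl ?_)
    rcases s with i | l
    · exact torelliGenerator_mem_span (.inr (.inr (.inr (.inl (i, j)))))
    · exact conj_y_mem_span (fun h => hs (congrArg Sum.inr h.symm)) (Or.inl rfl)

theorem K_le_normalizer :
    K n k ≤ Subgroup.normalizer (torelliSpan n k : Set (MulAut (F n k))) := by
  refine K_le_closure.trans ((Subgroup.closure_le _).mpr ?_)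
  rintro _ (h | ⟨⟨i, j⟩, rfl⟩)
  · exact Subgroup.le_normalizer h
  · exact leftMul_mem_normalizer i j

theorem commutator_leftMul_mem (i i' : Fin n) (j j' : Fin k) :
    ⁅transvection (Sum.inl i) (y j : F n k) 1, transvection (Sum.inl i') (y j') 1⁆ ∈
      torelliSpan n k := by
  have hy := y_mem_avoiding_inl (n := n) (k := k)
  by_cases hi : i = i'
  · subst hi
    have h := conj_mem_leftMultipliers (j := j) (Or.inr rfl)
      (inv_mem (commutator_yy_mem_leftMultipliers (a := j') (b := j) (z := (y j')⁻¹) i (Or.inr rfl)))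
    rw [commutatorElement_def, transvection_conj_self (hy i j) (one_mem _) (hy i j') (one_mem _),
      transvection_inv (hy i j') (one_mem _), mul_one, mul_inv_cancel,
      transvection_mul (mul_mem (mul_mem (inv_mem (hy i j)) (hy i j')) (hy i j)) (one_mem _)
        (inv_mem (hy i j')) (inv_mem (one_mem _)), inv_one, mul_one]
    convert h.2 using 2
    simp only [commutatorElement_def]
    group
  · rw [commutatorElement_eq_one_iff_mul_comm.mpr]
    · exact one_mem _
    · exact transvection_comm (fun h => hi (Sum.inl_injective h)) (hy i' j) (one_mem _) (hy i' j')
        (one_mem _) (hy i j') (one_mem _)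

theorem cls_of {α : Type*} [DecidableEq α] (s : α) :
    (cls α (of s)).toAdd = Pi.single s 1 := by
  simp [cls]

theorem cls_inl (w : F n k) (i : Fin n) :
    (cls (Fin n ⊕ Fin k) w).toAdd (Sum.inl i) = (cls (Fin n) (killY n k w)).toAdd i := by
  let φ : Multiplicative (Fin n ⊕ Fin k → ℤ) →* Multiplicative ℤ :=
    AddMonoidHom.toMultiplicative (Pi.evalAddMonoidHom (fun _ => ℤ) (Sum.inl i))
  let ψ : Multiplicative (Fin n → ℤ) →* Multiplicative ℤ :=
    AddMonoidHom.toMultiplicative (Pi.evalAddMonoidHom (fun _ => ℤ) i)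
  have h : φ.comp (cls (Fin n ⊕ Fin k)) = (ψ.comp (cls (Fin n))).comp (killY n k) := by
    ext1 s
    refine Multiplicative.toAdd.injective ?_
    change (cls _ (of s)).toAdd (Sum.inl i) = (cls _ (killY n k (of s))).toAdd i
    rcases s with l | j
    · have : killY n k (of (Sum.inl l)) = of l := killY_x l
      rw [this, cls_of, cls_of]
      simp [Pi.single_apply]
    · have : killY n k (of (Sum.inr j)) = 1 := killY_y j
      rw [this, cls_of, map_one]
      simp
  exact congrArg Multiplicative.toAdd (DFunLike.congr_fun h w)

theorem cls_inl_of_mem_K {g : MulAut (F n k)} (hg : g ∈ K n k) (w : F n k) (i : Fin n) :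
    (cls (Fin n ⊕ Fin k) (g w)).toAdd (Sum.inl i) =
      (cls (Fin n ⊕ Fin k) w).toAdd (Sum.inl i) := by
  rw [cls_inl, (mem_K_iff.mp hg).2, ← cls_inl]

theorem cls_inr_of_mem_K {g : MulAut (F n k)} (hg : g ∈ K n k) (w : F n k) (j : Fin k) :
    (cls (Fin n ⊕ Fin k) (g w)).toAdd (Sum.inr j) =
      (cls (Fin n ⊕ Fin k) w).toAdd (Sum.inr j) +
        ∑ i, (cls (Fin n ⊕ Fin k) w).toAdd (Sum.inl i) *
          (cls (Fin n ⊕ Fin k) (g (x i))).toAdd (Sum.inr j) := by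
  let φ : F n k →* Multiplicative ℤ := MonoidHom.mk'
    (fun w => Multiplicative.ofAdd ((cls (Fin n ⊕ Fin k) (g w)).toAdd (Sum.inr j)))
    fun v w => by
      rw [← ofAdd_add, map_mul, map_mul]
      rfl
  let ψ : F n k →* Multiplicative ℤ := MonoidHom.mk'
    (fun w => Multiplicative.ofAdd ((cls (Fin n ⊕ Fin k) w).toAdd (Sum.inr j) +
        ∑ i, (cls (Fin n ⊕ Fin k) w).toAdd (Sum.inl i) *
          (cls (Fin n ⊕ Fin k) (g (x i))).toAdd (Sum.inr j)))
    fun v w => by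
      rw [← ofAdd_add, map_mul, toAdd_mul]
      simp only [Pi.add_apply, add_mul, Finset.sum_add_distrib]
      congr 1
      abel
  have h : φ = ψ := by
    ext1 s
    refine congrArg Multiplicative.ofAdd ?_
    rcases s with i | l
    · rw [cls_of]
      simp [Pi.single_apply, x]
    · obtain ⟨c, hc⟩ := mem_autB_iff.mp (mem_K_iff.mp hg).1 _ ⟨l, rfl⟩
      have hc' : cls (Fin n ⊕ Fin k) (g (of (Sum.inr l))) = cls _ (of (Sum.inr l)) := by
        rw [hc, map_mul, map_mul, map_inv, mul_inv_cancel_comm]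
      rw [hc', cls_of]
      simp
  exact congrArg Multiplicative.toAdd (DFunLike.congr_fun h w)

variable (n k) in
/-- The homomorphism from `𝒦_{n,k}` to `ℤ^{nk}` recording the coefficients of the `[y_j]` in the
classes of the images of the `x_i`. -/
def coefficientHom : K n k →* Multiplicative (Fin n × Fin k → ℤ) :=
  MonoidHom.mk' (fun g => Multiplicative.ofAdd fun p =>
    (cls (Fin n ⊕ Fin k) (g.1 (x p.1))).toAdd (Sum.inr p.2)) fun f g => by
    rw [← ofAdd_add]
    congr 1
    funext p
    have h1 : (f * g).1 (x p.1) = f.1 (g.1 (x p.1)) := rfl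
    rw [h1, cls_inr_of_mem_K f.2, Finset.sum_eq_single p.1]
    · rw [cls_inl_of_mem_K g.2, x, cls_of, Pi.single_eq_same, one_mul, add_comm]
      rfl
    · intro i _ hi
      rw [cls_inl_of_mem_K g.2, x, cls_of,
        Pi.single_eq_of_ne fun h => hi (Sum.inl_injective h), zero_mul]
    · exact fun h => absurd (Finset.mem_univ _) h

theorem coefficientHom_of_mem_KIA {g : K n k} (hg : g.1 ∈ KIA n k) :
    coefficientHom n k g = 1 := by
  refine congrArg Multiplicative.ofAdd (funext fun p => ?_)
  rw [cls_of_mem_IA (Subgroup.mem_inf.mp hg).2, x, cls_of]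
  simp

/-- The Torelli part of the kernel of the Birman exact sequence is generated, modulo its
commutator subgroup, by the given generators. -/
theorem KIA_eq_torelliSpan : KIA n k = torelliSpan n k := by
  refine le_antisymm (fun g hg => ?_) torelliSpan_le_KIA
  have hgK : g ∈ K n k := (Subgroup.mem_inf.mp hg).1
  have hHK : torelliSpan n k ≤ K n k := torelliSpan_le_KIA.trans inf_le_left
  have hLK : ∀ p : Fin n × Fin k, transvection (Sum.inl p.1) (y p.2) 1 ∈ K n k := fun p =>
    transvection_inl_mem_K (y_mem_avoiding_inl _ _) (one_mem _) (killY_y _) (map_one _)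
  have hN : ((torelliSpan n k).subgroupOf (K n k)).Normal :=
    ⟨fun h hh g => (Subgroup.mem_normalizer_iff.mp (K_le_normalizer g.2) h.1).mp hh⟩
  have hgen : Subgroup.closure (((torelliSpan n k).subgroupOf (K n k) : Set (K n k)) ∪
      Set.range fun p : Fin n × Fin k => (⟨_, hLK p⟩ : K n k)) = ⊤ := by
    rw [eq_top_iff]
    rintro f -
    have h1 : f.1 ∈ (Subgroup.closure (((torelliSpan n k).subgroupOf (K n k) : Set (K n k)) ∪
        Set.range fun p : Fin n × Fin k => (⟨_, hLK p⟩ : K n k))).map (K n k).subtype := by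
      rw [MonoidHom.map_closure]
      refine Subgroup.closure_mono ?_ (K_le_closure f.2)
      rintro _ (h | ⟨p, rfl⟩)
      · exact ⟨⟨_, hHK h⟩, Or.inl h, rfl⟩
      · exact ⟨⟨_, hLK p⟩, Or.inr ⟨p, rfl⟩, rfl⟩
    obtain ⟨f', hf', he⟩ := h1
    exact Subtype.ext he ▸ hf'
  have := ker_le_of_commutator_mem (H := (torelliSpan n k).subgroupOf (K n k))
    (a := fun p : Fin n × Fin k => (⟨_, hLK p⟩ : K n k)) (coefficientHom n k) hgen
    (fun p q => commutator_leftMul_mem p.1 q.1 p.2 q.2)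
    (fun h hh => coefficientHom_of_mem_KIA (torelliSpan_le_KIA hh)) (fun p => by
      refine congrArg Multiplicative.ofAdd (funext fun q => ?_)
      change (cls (Fin n ⊕ Fin k)
        (transvection (Sum.inl p.1) (y p.2) 1 (x q.1))).toAdd (Sum.inr q.2) = _
      by_cases h : q.1 = p.1
      · have h1 : transvection (Sum.inl p.1) (y p.2) 1 (x p.1) = y p.2 * x p.1 * 1 :=
          transvection_of_self (y_mem_avoiding_inl _ _) (one_mem _)
        rw [h, h1, mul_one, map_mul, toAdd_mul, y, x, cls_of, cls_of]
        simp [Pi.single_apply, Prod.ext_iff, h]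
      · rw [transvection_of_mem _ _ (x_mem_avoiding_inl h), x, cls_of]
        simp [Prod.ext_iff, h])
  exact this (coefficientHom_of_mem_KIA (g := ⟨g, hgK⟩) hg)

end SpanNormal

/-! ### Independence of the Johnson images of the generators -/

section Independence

open scoped commutatorElement

/-- The coordinate of `⋀² ℤ^ι` with `a ∧ b ↦ a p * b q - a q * b p`. -/
def wedgeCoord {ι : Type*} (p q : ι) : ⋀[ℤ]^2 (ι → ℤ) →ₗ[ℤ] ℤ :=
  exteriorPower.alternatingMapLinearEquiv
    (Matrix.detRowAlternating.compLinearMap (LinearMap.funLeft ℤ ℤ ![p, q]))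

theorem wedgeCoord_wedge {ι : Type*} (p q : ι) (a b : ι → ℤ) :
    wedgeCoord p q (wedge a b) = a p * b q - a q * b p := by
  rw [wedgeCoord, wedge, exteriorPower.alternatingMapLinearEquiv_apply_ιMulti]
  exact Matrix.det_fin_two _

theorem johnsonVal_eq_wedge {ι : Type*} [Fintype ι] [DecidableEq ι] (f : IA ι)
    {z u v : FreeGroup ι} (h : f.1 z * z⁻¹ = ⁅u, v⁆) :
    johnsonVal ι f z = wedge (cls ι u).toAdd (cls ι v).toAdd := by
  have hc : ⁅u, v⁆ ∈ commutator (FreeGroup ι) := h ▸ mul_inv_mem_commutator f.2 z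
  rw [← commProj_commutator ι u v hc]
  simp only [johnsonVal, h]

variable {n k : ℕ}

/-- The basis element moved by a generator. -/
def movedIndex : GeneratorIndex n k → Fin n ⊕ Fin k
  | .inl (p, _) => .inl p.1.1
  | .inr (.inl (i, _)) => .inl i
  | .inr (.inr (.inl (i, _))) => .inl i
  | .inr (.inr (.inr (.inl (_, j)))) => .inr j
  | .inr (.inr (.inr (.inr p))) => .inr p.1.1

/-- The pair of basis elements such that a generator multiplies the basis element that it moves
by their commutator. -/
def commutatorPair : GeneratorIndex n k → (Fin n ⊕ Fin k) × (Fin n ⊕ Fin k)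
  | .inl (p, j) => (.inl p.1.2, .inr j)
  | .inr (.inl (_, p)) => (.inr p.1.1, .inr p.1.2)
  | .inr (.inr (.inl (i, j))) => (.inr j, .inl i)
  | .inr (.inr (.inr (.inl (i, j)))) => (.inl i, .inr j)
  | .inr (.inr (.inr (.inr p))) => (.inr p.1.2, .inr p.1.1)

theorem torelliGenerator_apply_moved (s : GeneratorIndex n k) :
    torelliGenerator s (of (movedIndex s)) * (of (movedIndex s))⁻¹ =
      ⁅of (commutatorPair s).1, of (commutatorPair s).2⁆ := by
  have hx : ∀ {i l : Fin n}, l ≠ i → (x l : F n k) ∈ avoiding (Sum.inl i) := x_mem_avoiding_inl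
  have hxr := x_mem_avoiding_inr (n := n) (k := k)
  have hy := y_mem_avoiding_inl (n := n) (k := k)
  have hyr : ∀ {a b : Fin k}, b ≠ a → (y b : F n k) ∈ avoiding (Sum.inr a) := y_mem_avoiding_inr
  rcases s with ⟨⟨⟨i, l⟩, hil⟩, j⟩ | ⟨i, ⟨⟨a, b⟩, hab⟩⟩ | ⟨i, j⟩ | ⟨i, j⟩ | ⟨⟨a, b⟩, hab⟩
  · rw [torelliGenerator, movedIndex, transvection_of_self
      (commutator_mem_avoiding (hx (Ne.symm hil)) (hy i j)) (one_mem _), mul_one,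
      mul_inv_cancel_right]
    rfl
  · rw [torelliGenerator, movedIndex, transvection_of_self
      (commutator_mem_avoiding (hy i a) (hy i b)) (one_mem _), mul_one, mul_inv_cancel_right]
    rfl
  · rw [torelliGenerator, movedIndex, transvection_of_self (hy i j) (inv_mem (hy i j))]
    rfl
  · rw [torelliGenerator, movedIndex, transvection_of_self (hxr i j) (inv_mem (hxr i j))]
    rfl
  · have h := hyr (Ne.symm hab)
    rw [torelliGenerator, movedIndex, transvection_of_self h (inv_mem h)]
    rfl

theorem torelliGenerator_apply_of_ne (s : GeneratorIndex n k) {t : Fin n ⊕ Fin k}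
    (ht : t ≠ movedIndex s) : torelliGenerator s (of t) = of t := by
  rcases s with ⟨p, j⟩ | ⟨i, p⟩ | ⟨i, j⟩ | ⟨i, j⟩ | p <;> exact transvection_of_ne _ _ ht

theorem commutatorPair_fst_ne_snd (s : GeneratorIndex n k) :
    (commutatorPair s).1 ≠ (commutatorPair s).2 := by
  rcases s with ⟨⟨⟨i, l⟩, hil⟩, j⟩ | ⟨i, ⟨⟨a, b⟩, hab⟩⟩ | ⟨i, j⟩ | ⟨i, j⟩ | ⟨⟨a, b⟩, hab⟩
  · simp [commutatorPair]
  · simpa [commutatorPair] using hab.ne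
  · simp [commutatorPair]
  · simp [commutatorPair]
  · simpa [commutatorPair] using Ne.symm hab

/-- A generator is determined by the basis element that it moves and the pair of basis elements
in its commutator. -/
theorem eq_of_commutatorPair_eq {s t : GeneratorIndex n k} (h : movedIndex s = movedIndex t)
    (h' : commutatorPair s = commutatorPair t) : s = t := by
  rcases s with ⟨⟨⟨i, l⟩, hil⟩, j⟩ | ⟨i, ⟨⟨a, b⟩, hab⟩⟩ | ⟨i, j⟩ | ⟨i, j⟩ | ⟨⟨a, b⟩, hab⟩ <;>
  rcases t with ⟨⟨⟨i', l'⟩, hil'⟩, j'⟩ | ⟨i', ⟨⟨a', b'⟩, hab'⟩⟩ | ⟨i', j'⟩ | ⟨i', j'⟩ |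
    ⟨⟨a', b'⟩, hab'⟩ <;>
  simp_all [movedIndex, commutatorPair]

/-- The pairs of basis elements in the commutators of generators moving the same basis element
are never opposite to each other. -/
theorem commutatorPair_ne_swap {s t : GeneratorIndex n k} (h : movedIndex s = movedIndex t) :
    commutatorPair s ≠ (commutatorPair t).swap := by
  rcases s with ⟨⟨⟨i, l⟩, hil⟩, j⟩ | ⟨i, ⟨⟨a, b⟩, hab⟩⟩ | ⟨i, j⟩ | ⟨i, j⟩ | ⟨⟨a, b⟩, hab⟩ <;>
  rcases t with ⟨⟨⟨i', l'⟩, hil'⟩, j'⟩ | ⟨i', ⟨⟨a', b'⟩, hab'⟩⟩ | ⟨i', j'⟩ | ⟨i', j'⟩ |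
    ⟨⟨a', b'⟩, hab'⟩ <;>
  simp_all [movedIndex, commutatorPair]
  · rintro rfl rfl
    exact hil h
  · rintro rfl rfl
    exact lt_asymm hab hab'

/-- The generators as elements of the Torelli part of the kernel. -/
def generatorKIA (s : GeneratorIndex n k) : KIA n k :=
  ⟨torelliGenerator s, torelliGenerator_mem_KIA s⟩

theorem johnsonKIA_single (g : KIA n k) (t : Fin n ⊕ Fin k) :
    (johnsonKIA n k g).toAdd (Pi.single t 1) =
      johnsonVal (Fin n ⊕ Fin k) (Subgroup.inclusion inf_le_right g) (of t) := by
  rw [← johnsonLin_cls, cls_of]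
  rfl

theorem johnsonKIA_generator_moved (s : GeneratorIndex n k) :
    (johnsonKIA n k (generatorKIA s)).toAdd (Pi.single (movedIndex s) 1) =
      wedge (Pi.single (commutatorPair s).1 1) (Pi.single (commutatorPair s).2 1) := by
  rw [johnsonKIA_single, johnsonVal_eq_wedge _ (torelliGenerator_apply_moved s), cls_of, cls_of]

theorem johnsonKIA_generator_of_ne (s : GeneratorIndex n k) {t : Fin n ⊕ Fin k}
    (ht : t ≠ movedIndex s) :
    (johnsonKIA n k (generatorKIA s)).toAdd (Pi.single t 1) = 0 := by
  have h : torelliGenerator s (of t) * (of t)⁻¹ = ⁅(1 : F n k), 1⁆ := by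
    rw [torelliGenerator_apply_of_ne s ht, mul_inv_cancel, commutatorElement_self]
  rw [johnsonKIA_single, johnsonVal_eq_wedge _ h, wedge_self]

/-- The Johnson images of the generators are linearly independent, as they are distinct elements
of the standard basis of `Hom(ℤ^{n+k}, ⋀² ℤ^{n+k})` up to sign. -/
theorem linearIndependent_johnsonKIA_generator : LinearIndependent ℤ
    fun s : GeneratorIndex n k => (johnsonKIA n k (generatorKIA s)).toAdd := by
  refine LinearIndependent.of_pairwise_dual_eq_zero_one _ (fun s =>
    (wedgeCoord (commutatorPair s).1 (commutatorPair s).2).comp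
      (LinearMap.applyₗ (Pi.single (movedIndex s) 1))) (fun s t hst => ?_) fun s => ?_
  · change wedgeCoord _ _ ((johnsonKIA n k (generatorKIA t)).toAdd _) = 0
    by_cases h : movedIndex s = movedIndex t
    · rw [h, johnsonKIA_generator_moved, wedgeCoord_wedge]
      have h1 : ¬ ((commutatorPair s).1 = (commutatorPair t).1 ∧
          (commutatorPair s).2 = (commutatorPair t).2) := fun h' =>
        hst (eq_of_commutatorPair_eq h (Prod.ext h'.1 h'.2))
      have h2 : ¬ ((commutatorPair s).2 = (commutatorPair t).1 ∧
          (commutatorPair s).1 = (commutatorPair t).2) := fun h' =>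
        commutatorPair_ne_swap h (Prod.ext h'.2 h'.1)
      simp only [Pi.single_apply, mul_ite, mul_one, mul_zero, ← ite_and]
      rw [if_neg fun h' => h1 h'.symm, if_neg fun h' => h2 h'.symm, sub_zero]
    · rw [johnsonKIA_generator_of_ne t h, map_zero]
  · change wedgeCoord _ _ ((johnsonKIA n k (generatorKIA s)).toAdd _) = 1
    have h := commutatorPair_fst_ne_snd s
    rw [johnsonKIA_generator_moved, wedgeCoord_wedge, Pi.single_eq_same, Pi.single_eq_same,
      Pi.single_eq_of_ne h, mul_zero, mul_one, sub_zero]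

theorem card_ne_pairs (m : ℕ) :
    Fintype.card {p : Fin m × Fin m // p.1 ≠ p.2} = m * (m - 1) := by
  rw [Fintype.card_of_subtype (Finset.univ.offDiag) (fun p => by simp), Finset.offDiag_card,
    Finset.card_univ, Fintype.card_fin, Nat.mul_sub_one]

theorem card_lt_pairs (m : ℕ) :
    Fintype.card {p : Fin m × Fin m // p.1 < p.2} = m.choose 2 := by
  have h1 : Fintype.card {p : Fin m × Fin m // p.1 ≠ p.2} =
      Fintype.card {p : Fin m × Fin m // p.1 < p.2} +
        Fintype.card {p : Fin m × Fin m // p.2 < p.1} := by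
    rw [← Fintype.card_subtype_or_disjoint]
    · exact Fintype.card_congr (Equiv.subtypeEquivRight fun p => ne_iff_lt_or_gt)
    · rw [Pi.disjoint_iff]
      intro p
      rw [Prop.disjoint_iff]
      by_contra! h
      exact lt_asymm h.1 h.2
  have h2 : Fintype.card {p : Fin m × Fin m // p.2 < p.1} =
      Fintype.card {p : Fin m × Fin m // p.1 < p.2} :=
    Fintype.card_congr ((Equiv.prodComm _ _).subtypeEquiv fun p => Iff.rfl)
  rw [card_ne_pairs, h2] at h1
  rw [Nat.choose_two_right]
  omega

variable (n k) in
theorem card_generatorIndex : Fintype.card (GeneratorIndex n k) =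
    n * (n - 1) * k + n * k.choose 2 + 2 * n * k + k * (k - 1) := by
  simp only [GeneratorIndex, Fintype.card_sum, Fintype.card_prod, card_ne_pairs, card_lt_pairs,
    Fintype.card_fin]
  ring

end Independence

/-! ### The first homology group -/

section FirstHomology

open scoped commutatorElement

variable (G : Type) [Group G]

/-- The first homology group is the abelianization. -/
def abelianizationEquivH1 : Additive (Abelianization G) ≃+ H1 G :=
  (TensorProduct.rid ℤ (Additive (Abelianization G))).symm.toAddEquiv.trans
    (groupHomology.H1AddEquivOfIsTrivial (Rep.trivial ℤ G ℤ)).symm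

theorem abelianizationEquivH1_of (g : G) :
    abelianizationEquivH1 G (Additive.ofMul (Abelianization.of g)) = h1Class g := rfl

variable {G} in
theorem h1Class_mul (g h : G) : h1Class (g * h) = h1Class g + h1Class h := by
  rw [← abelianizationEquivH1_of, map_mul, ofMul_mul, map_add, abelianizationEquivH1_of,
    abelianizationEquivH1_of]

variable {G} in
theorem exists_h1Class_eq (a : H1 G) : ∃ g : G, h1Class g = a := by
  obtain ⟨b, rfl⟩ := (abelianizationEquivH1 G).surjective a
  obtain ⟨g, hg⟩ := QuotientGroup.mk_surjective b.toMul
  exact ⟨g, (abelianizationEquivH1_of G g).symm.trans (congrArg _ (congrArg Additive.ofMul hg))⟩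

variable {G} in
/-- The linear map on the first homology group induced by a homomorphism to an abelian group. -/
def h1Lift {M : Type*} [AddCommGroup M] (φ : G →* Multiplicative M) : H1 G →ₗ[ℤ] M :=
  let f : H1 G →+ M := (MonoidHom.toAdditiveLeft (Abelianization.lift φ)).comp
    (abelianizationEquivH1 G).symm.toAddMonoidHom
  { f with map_smul' := fun r a => by simpa using map_intCast_smul f ℤ ℤ r a }

variable {G} in
theorem h1Lift_h1Class {M : Type*} [AddCommGroup M] (φ : G →* Multiplicative M) (g : G) :
    h1Lift φ (h1Class g) = (φ g).toAdd := by
  change MonoidHom.toAdditiveLeft (Abelianization.lift φ)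
    ((abelianizationEquivH1 G).symm (h1Class g)) = _
  rw [← abelianizationEquivH1_of, AddEquiv.symm_apply_apply]
  rfl

variable {n k : ℕ}

theorem span_h1Class_generatorKIA :
    Submodule.span ℤ (Set.range fun s : GeneratorIndex n k => h1Class (generatorKIA s)) = ⊤ := by
  rw [eq_top_iff]
  rintro a -
  obtain ⟨g, rfl⟩ := exists_h1Class_eq a
  let φ : KIA n k →* Multiplicative (H1 (KIA n k)) :=
    MonoidHom.mk' (fun g => Multiplicative.ofAdd (h1Class g)) fun g h => by
      rw [h1Class_mul, ofAdd_add]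
  let N : Subgroup (KIA n k) := (AddSubgroup.toSubgroup (Submodule.span ℤ
    (Set.range fun s : GeneratorIndex n k => h1Class (generatorKIA s))).toAddSubgroup).comap φ
  have hN : KIA n k ≤ N.map (KIA n k).subtype := by
    nth_rw 1 [KIA_eq_torelliSpan]
    refine sup_le ((Subgroup.closure_le _).mpr ?_) (Subgroup.commutator_le.mpr ?_)
    · rintro _ ⟨s, rfl⟩
      exact ⟨generatorKIA s, Submodule.subset_span ⟨s, rfl⟩, rfl⟩
    · intro g hg h hh
      refine ⟨⁅(⟨g, hg⟩ : KIA n k), (⟨h, hh⟩ : KIA n k)⁆, ?_, rfl⟩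
      have h1 : φ ⁅(⟨g, hg⟩ : KIA n k), (⟨h, hh⟩ : KIA n k)⁆ = 1 := by
        rw [map_commutatorElement, commutatorElement_eq_one_iff_mul_comm, mul_comm]
      rw [SetLike.mem_coe, Subgroup.mem_comap, h1]
      exact one_mem _
  obtain ⟨g', hg', he⟩ := hN g.2
  obtain rfl : g' = g := Subtype.ext he
  exact hg'

end FirstHomology

end BirmanTorelli

end

theorem theoremC (n k : ℕ) :
    Module.Free ℤ (BirmanTorelli.H1 (BirmanTorelli.KIA n k)) ∧
    Module.Finite ℤ (BirmanTorelli.H1 (BirmanTorelli.KIA n k)) ∧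
    Module.finrank ℤ (BirmanTorelli.H1 (BirmanTorelli.KIA n k)) =
      n * (n - 1) * k + n * k.choose 2 + 2 * n * k + k * (k - 1) ∧
    ∃ J : BirmanTorelli.H1 (BirmanTorelli.KIA n k) →ₗ[ℤ]
        ((Fin n ⊕ Fin k → ℤ) →ₗ[ℤ] ⋀[ℤ]^2 (Fin n ⊕ Fin k → ℤ)),
      Function.Injective J ∧
      ∀ g : BirmanTorelli.KIA n k,
        J (BirmanTorelli.h1Class g) = (BirmanTorelli.johnsonKIA n k g).toAdd := by
  open BirmanTorelli in
  have hJ := h1Lift_h1Class (johnsonKIA n k)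
  have hli : LinearIndependent ℤ
      (h1Lift (johnsonKIA n k) ∘ fun s => h1Class (generatorKIA (n := n) (k := k) s)) := by
    convert linearIndependent_johnsonKIA_generator (n := n) (k := k) using 1
    funext s
    exact hJ _
  let b := Module.Basis.mk hli.of_comp span_h1Class_generatorKIA.ge
  refine ⟨.of_basis b, .of_basis b, ?_, h1Lift (johnsonKIA n k), ?_, hJ⟩
  · rw [Module.finrank_eq_card_basis b, card_generatorIndex]
  · rw [injective_iff_map_eq_zero]
    intro a ha
    rw [← b.linearCombination_repr a] at ha ⊢
    rw [Finsupp.apply_linearCombination] at ha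
    have hb : h1Lift (johnsonKIA n k) ∘ b =
        h1Lift (johnsonKIA n k) ∘ fun s => h1Class (generatorKIA s) := by
      rw [Module.Basis.coe_mk]
    rw [hb] at ha
    rw [(linearIndependent_iff.mp hli) _ ha, map_zero]
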